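/- Let $m\ge 1$ and let $0<k_1<\dots<k_m<d$ be integers with $\gcd(k_1,\dots,k_m,d)=1$. Let $$A=\begin{pmatrix}1&1&\cdots&1&1\\0&k_1&\cdots&k_m&d\end{pmatrix},\qquad f(x;t)=x_0+x_{k_1}t^{k_1}+\dots+x_{k_m}t^{k_m}+x_dt^d ,$$ with $x=(x_0,x_{k_1},\dots,x_{k_m},x_d)\in\mathbb C^{m+2}$, let $D_j=\partial/\partial x_j$, $D_u=\prod_j D_j^{u_j}$ for $u\in\mathbb N^{m+2}$ (with $0\in\mathbb N$), and let $\Sigma=\{x_0=0\}\cup\{x_d=0\}\cup\{\Delta(f)=0\}$, where $\Delta(f)$ is the discriminant of $f$ with respect to $t$. For $\alpha\in\mathbb Z^2$ and $U\subseteq\mathbb C^{m+2}$ open, $\mathcal H(\alpha)(U)$ is the space of holomorphic functions $\varphi$ on $U$ that satisfy the $A$-hypergeometric system with exponent $\alpha$, that is, $D_u\varphi=D_{u'}\varphi$ with $u=v^+$, $u'=v^-$ the positive and negative parts of $v$, for all $v\in\mathbb Z^{m+2}$ with $Av=0$, and $\sum_j x_jD_j\varphi=\alpha_1\varphi$, $\sum_j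 j\,x_jD_j\varphi=\alpha_2\varphi$ (the sums are over $j\in\{0,k_1,\dots,k_m,d\}$). Let $B$ and $C$ be $A$ without its last and without its first column, respectively, and put $$J(A)=\mathbb Z^2\setminus\Bigl(A\,\mathbb N^{m+2}\ \cup\ \bigl(C\,\mathbb N^{m+1}-\mathbb N(1,0)\bigr)\ \cup\ \bigl(B\,\mathbb N^{m+1}-\mathbb N(1,d)\bigr)\Bigr).$$ Put $\Phi(\alpha;x)=\sum_{u\in\mathbb N^{m+2},\,Au=\alpha}x^u/u!$. Let $U\subseteq\mathbb C^{m+2}\setminus\Sigma$ be open and simply connected, let $\rho_1,\dots,\rho_d$ be the distinct roots of $f(x;\cdot)$, holomorphic on $U$, and choose holomorphic branches of $\log\rho_1,\dots,\log\rho_d$ on $U$. For $\alpha\in\mathbb Z^2$ with $\alpha_1\ge 0$ let $$\psi_j(\alpha)=\sum_{\substack{0\le i\le d\alpha_1\\ i\ne\alpha_2}}\Phi((\alpha_1,i);x)\,\frac{\rho_j^{\,i-\alpha_2}}{i-\alpha_2}+\Phi(\alpha;x)\log\rho_j,\qquad \chi(\alpha)=\sum_{j=1}^d\psi_j(\alpha)\log\rho_j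 ,$$ and for $\alpha_1<0$ let $\psi_j(\alpha)=D_0^{-\alpha_1}\psi_j((0,\alpha_2))$ and $$\chi(\alpha)=\begin{cases}D_0^{-\alpha_1}\chi((0,\alpha_2)),&\alpha_2\ne0,\\ D_{k_1}D_0^{-\alpha_1-1}\chi((0,k_1)),&\alpha_2=0.\end{cases}$$ Theorem 3.5. Let $\alpha\in J(A)$. Then $\psi_1(\alpha),\dots,\psi_d(\alpha)$ and $\chi(\alpha)$ belong to $\mathcal H(\alpha)(U)$, and the $d$ functions $\psi_1(\alpha),\dots,\psi_{d-1}(\alpha),\chi(\alpha)$ are linearly independent over $\mathbb C$. Moreover, $\chi(\alpha)$ is not algebraic: there is no non-zero polynomial $P\in\mathbb C[x][T]$ with $P(x,\chi(\alpha)(x))=0$ for all $x\in U$. -/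

import Mathlib

noncomputable section

namespace MonomialCurve

/-! ### The `A`-hypergeometric system of an integer matrix -/

/-- The partial derivative `∂φ/∂x_j`. -/
def pd {n : ℕ} (j : Fin n) (φ : (Fin n → ℂ) → ℂ) : (Fin n → ℂ) → ℂ :=
  fun x => fderiv ℂ φ x (Pi.single j 1)

/-- The iterated partial derivative `D_u = ∂^{|u|}/∂x^u`, the composition over `j` of the
`u j`-fold partial derivatives with respect to `x_j` (on holomorphic functions the order of the
composition does not matter). -/
def pdMulti {n : ℕ} (u : Fin n → ℕ) (φ : (Fin n → ℂ) → ℂ) : (Fin n → ℂ) → ℂ :=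
  (List.finRange n).foldr (fun j g => (pd j)^[u j] g) φ

/-- `φ` is, on the open set `U`, a holomorphic solution of the `A`-hypergeometric system with
exponent `α`: it satisfies the toric equations `D_{v⁺} φ = D_{v⁻} φ` for all integer vectors `v`
in the kernel of `A`, and the homogeneity equations, one for each row of `A`. -/
structure IsHypergeometricOn {r n : ℕ} (A : Matrix (Fin r) (Fin n) ℤ) (α : Fin r → ℂ)
    (U : Set (Fin n → ℂ)) (φ : (Fin n → ℂ) → ℂ) : Prop where
  holomorphic : DifferentiableOn ℂ φ U
  toric : ∀ v : Fin n → ℤ, A.mulVec v = 0 → ∀ x ∈ U,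
    pdMulti (fun j => (v j).toNat) φ x = pdMulti (fun j => (-v j).toNat) φ x
  homogeneous : ∀ i : Fin r, ∀ x ∈ U,
    ∑ j, (A i j : ℂ) * x j * pd j φ x = α i * φ x

/-- `φ` is algebraic on `U`: it satisfies a non-trivial polynomial equation whose coefficients are
polynomials in the coordinates. -/
def IsAlgebraicOn {n : ℕ} (U : Set (Fin n → ℂ)) (φ : (Fin n → ℂ) → ℂ) : Prop :=
  ∃ P : Polynomial (MvPolynomial (Fin n) ℂ), P ≠ 0 ∧
    ∀ x ∈ U, (P.map (MvPolynomial.eval x)).eval (φ x) = 0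

/-! ### The matrix of a monomial curve

The exponents `0 < k_1 < ⋯ < k_m < d` are given as a function `k : Fin (m + 2) → ℕ` with
`k 0 = 0`, `k i = k_i` for `1 ≤ i ≤ m` and `k (m + 1) = d`; the variables `x_0, x_{k_1}, …, x_d`
are the coordinates `x 0, x 1, …, x (m + 1)`. An exponent `α = (α_1, α_2)` is a function on
`Fin 2`, so that `α 0` is `α_1` and `α 1` is `α_2`. -/

variable {m : ℕ}

/-- The degree `d` of the curve. -/
def deg (k : Fin (m + 2) → ℕ) : ℕ := k (Fin.last (m + 1))

/-- The matrix `A` with rows `(1, 1, …, 1, 1)` and `(0, k_1, …, k_m, d)`. -/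
def curveMatrix (k : Fin (m + 2) → ℕ) : Matrix (Fin 2) (Fin (m + 2)) ℤ :=
  Matrix.of ![fun _ => 1, fun j => (k j : ℤ)]

/-- The polynomial `f(x; t) = x_0 + x_{k_1} t^{k_1} + ⋯ + x_d t^d` in `t`. -/
def genericPoly (k : Fin (m + 2) → ℕ) (x : Fin (m + 2) → ℂ) : Polynomial ℂ :=
  ∑ j, Polynomial.monomial (k j) (x j)

/-- The singular locus `Σ = {x_0 = 0} ∪ {x_d = 0} ∪ {Δ(f) = 0}`. -/
def singularLocus (k : Fin (m + 2) → ℕ) : Set (Fin (m + 2) → ℂ) :=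
  {x | x 0 = 0} ∪ {x | x (Fin.last (m + 1)) = 0} ∪ {x | (genericPoly k x).discr = 0}

/-- `I(A) = A · ℕ^{m+2}`. -/
def setI (k : Fin (m + 2) → ℕ) : Set (Fin 2 → ℤ) :=
  {α | ∃ u : Fin (m + 2) → ℕ, α = (curveMatrix k).mulVec (fun j => (u j : ℤ))}

/-- `F_0(A) = C · ℕ^{m+1} - ℕ (1, 0)`, where `C` is `A` without its first column. -/
def setF0 (k : Fin (m + 2) → ℕ) : Set (Fin 2 → ℤ) :=
  {α | ∃ (w : Fin (m + 1) → ℕ) (n : ℕ),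
    α = ((curveMatrix k).submatrix id Fin.succ).mulVec (fun j => (w j : ℤ)) - (n : ℤ) • ![1, 0]}

/-- `F_d(A) = B · ℕ^{m+1} - ℕ (1, d)`, where `B` is `A` without its last column. -/
def setFd (k : Fin (m + 2) → ℕ) : Set (Fin 2 → ℤ) :=
  {α | ∃ (w : Fin (m + 1) → ℕ) (n : ℕ),
    α = ((curveMatrix k).submatrix id Fin.castSucc).mulVec (fun j => (w j : ℤ))
      - (n : ℤ) • ![1, (deg k : ℤ)]}

/-- `J(A) = ℤ² \ (I(A) ∪ F_0(A) ∪ F_d(A))`. -/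
def setJ (k : Fin (m + 2) → ℕ) : Set (Fin 2 → ℤ) :=
  (setI k ∪ setF0 k ∪ setFd k)ᶜ

/-- The hypergeometric polynomial `Φ(α; x) = ∑ x^u / u!`, the sum over all `u ∈ ℕ^{m+2}` with
`A u = α`. Such `u` have coordinate sum `α_1`, which makes the sum finite. -/
def Phi (k : Fin (m + 2) → ℕ) (α : Fin 2 → ℤ) (x : Fin (m + 2) → ℂ) : ℂ :=
  ∑ u ∈ (Finset.piAntidiag Finset.univ (α 0).toNat).filter
      (fun u : Fin (m + 2) → ℕ => (curveMatrix k).mulVec (fun j => (u j : ℤ)) = α),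
    ∏ j, x j ^ u j / ((u j).factorial : ℂ)

/-! ### The functions `ψ_ρ(α)` and `χ(α)`

Here `ρ` is a root of `f(x; t)`, as a function of `x`, and `L` is a branch of `log ρ`. -/

/-- `ψ_ρ(α)` for `α_1 ≥ 0`:
`∑_{0 ≤ i ≤ d α_1, i ≠ α_2} Φ((α_1, i)) ρ^{i - α_2} / (i - α_2) + Φ(α) log ρ`. -/
def psiNonneg (k : Fin (m + 2) → ℕ) (ρ L : (Fin (m + 2) → ℂ) → ℂ) (α : Fin 2 → ℤ) :
    (Fin (m + 2) → ℂ) → ℂ := fun x =>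
  (∑ i ∈ (Finset.range (deg k * (α 0).toNat + 1)).filter (fun i : ℕ => (i : ℤ) ≠ α 1),
      Phi k ![α 0, (i : ℤ)] x * (ρ x ^ ((i : ℤ) - α 1) / (((i : ℤ) - α 1 : ℤ) : ℂ)))
    + Phi k α x * L x

/-- `ψ_ρ(α)` for all `α ∈ ℤ²`. For `α_1 < 0` it is `D_u ψ_ρ(α + A u)` for any `u ∈ ℕ^{m+2}` with
`|u| ≥ -α_1`; the result does not depend on `u`, and the choice made here is
`u = (-α_1, 0, …, 0)`, for which `α + A u = (0, α_2)`. -/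
def psi (k : Fin (m + 2) → ℕ) (ρ L : (Fin (m + 2) → ℂ) → ℂ) (α : Fin 2 → ℤ) :
    (Fin (m + 2) → ℂ) → ℂ :=
  if 0 ≤ α 0 then psiNonneg k ρ L α
  else (pd 0)^[(-α 0).toNat] (psiNonneg k ρ L ![0, α 1])

/-- `χ(α) = ∑_j ψ_j(α) log ρ_j` for `α_1 ≥ 0`. -/
def chiNonneg (k : Fin (m + 2) → ℕ) (ρ L : Fin (deg k) → (Fin (m + 2) → ℂ) → ℂ)
    (α : Fin 2 → ℤ) : (Fin (m + 2) → ℂ) → ℂ := fun x =>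
  ∑ j, psi k (ρ j) (L j) α x * L j x

/-- `χ(α)` for all `α ∈ ℤ²`: for `α_1 < 0` it is `D_0^{-α_1} χ((0, α_2))` if `α_2 ≠ 0`, and
`D_{k_1} D_0^{-α_1 - 1} χ((0, k_1))` if `α_2 = 0`. -/
def chi (k : Fin (m + 2) → ℕ) (ρ L : Fin (deg k) → (Fin (m + 2) → ℂ) → ℂ)
    (α : Fin 2 → ℤ) : (Fin (m + 2) → ℂ) → ℂ :=
  if 0 ≤ α 0 then chiNonneg k ρ L α
  else if α 1 ≠ 0 then (pd 0)^[(-α 0).toNat] (chiNonneg k ρ L ![0, α 1])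
  else pd 1 ((pd 0)^[(-α 0 - 1).toNat] (chiNonneg k ρ L ![0, (k 1 : ℤ)]))

end MonomialCurve

end

/-! Write an exponent as `(n, a)`. Up to its constant of integration, `ψ_ρ(n, a)` is the primitive
of `t^(-a-1) f^n / n!` evaluated at the moving endpoint `t = ρ`. For `n ≥ 1` the endpoint
contributes nothing to a derivative because `f(ρ) = 0`, and differentiation under the integral gives
`D_i ψ(n, a) = ψ(n-1, a-k_i)`; for `n ≤ 0` the same rule holds because `D_i ψ(0, a)` depends only on
`a - k_i`. Hence `D_u` shifts the exponent by `-A u`, which gives the toric equations. The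
homogeneity equations come from `f = ∑ x_i t^{k_i}` and from an integration by parts whose only
defect is the coefficient `Φ(n, a)`.

Membership in `J(A)` gives `IsGap`: `a` avoids the semigroup of the `k_j`, and `d n - a` that of the
`d - k_j`. This persists under subtraction of columns of `A`, so differentiation never leaves the
gaps. On gaps `Φ` vanishes, so that no logarithm occurs in `ψ`, and moreover `∑_j ψ_j = 0`
(`RootSystem.psiSum_eq_zero`): everything reduces to the sums `∑ ρ^s / f'(ρ)`, which obey a linear
recurrence and whose dependence on `x_0` can be followed. The error terms `∑_j ψ_j D_i(log ρ_j)` in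
the derivatives of `χ` are of the same kind, so `χ` satisfies the shift rule and the homogeneity
equations too.

For independence and transcendence, differentiation leads from one exponent to a long interval of
exponents in degree `-M-1`. There the `ψ_j` are, up to a scalar, residues at `ρ_j` of `t^l` times a
fixed function with denominator `f^(M+1)`. Taking the combination whose coefficients are those of a
polynomial vanishing to high order at all roots but two isolates these two. Applied to a linear
relation with one zero coefficient, it kills every other coefficient. Applied to `χ`, it shows that
if `χ` is algebraic, so is `log ρ_j - log ρ_i` (`RootSystem.log_sub_log_mem`). But an algebraic
function whose exponential is algebraic has zero derivatives
(`derivation_eq_zero_of_exp_isAlgebraic`), and then the coprimality of the exponents forces `ρ_i =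
ρ_j`.

The argument is purely differential-algebraic and is carried out over an abstract domain with
derivations; the domain is finally taken to be the ring of analytic functions on `U`. -/

noncomputable section

namespace MonomialCurve

/-! ### Differential algebra: an algebraic element with algebraic exponential is a constant. -/

section ExponentialTranscendence

open Polynomial

section Algebraic

variable {A R : Type*} [CommRing A] [IsDomain A] [CommRing R] [IsDomain R] [Algebra ℂ R]
  [Algebra A R]

/-- Differentiating `p(φ) = 0` for `p` of least degree gives `p'(φ) D φ = -s` with `s` algebraic,
and `p'(φ) ≠ 0` by minimality. -/
theorem isAlgebraic_derivation_apply [CharZero A]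
    (hinj : Function.Injective (algebraMap A R)) (D : Derivation ℂ R R)
    (hD : ∀ a : A, IsAlgebraic A (D (algebraMap A R a))) {φ : R} (hφ : IsAlgebraic A φ) :
    IsAlgebraic A (D φ) := by
  have key : ∀ p : A[X], ∃ s : R, IsAlgebraic A s ∧
      D (aeval φ p) = s + aeval φ (derivative p) * D φ := by
    intro p
    induction p using Polynomial.induction_on' with
    | add p q hp hq =>
      obtain ⟨s, hs, h1⟩ := hp
      obtain ⟨t, ht, h2⟩ := hq
      exact ⟨s + t, hs.add ht, by simp only [map_add, h1, h2]; ring⟩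
    | monomial n a =>
      refine ⟨D (algebraMap A R a) * φ ^ n, (hD a).mul (hφ.pow n), ?_⟩
      simp only [aeval_monomial, derivative_monomial, Derivation.leibniz, Derivation.leibniz_pow,
        smul_eq_mul, nsmul_eq_mul, map_mul, map_natCast]
      ring
  have hex : ∃ N, ∃ p : A[X], p ≠ 0 ∧ aeval φ p = 0 ∧ p.natDegree = N := by
    obtain ⟨p, hp, h⟩ := hφ
    exact ⟨_, p, hp, h, rfl⟩
  classical
  obtain ⟨p, hp0, hp, hdeg⟩ := Nat.find_spec hex
  have hmin : ∀ q : A[X], q ≠ 0 → aeval φ q = 0 → p.natDegree ≤ q.natDegree := by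
    intro q hq h
    rw [hdeg]
    exact Nat.find_min' hex ⟨q, hq, h, rfl⟩
  have hpos : p.natDegree ≠ 0 := by
    intro h
    rw [eq_C_of_natDegree_eq_zero h, aeval_C] at hp
    have := hinj (hp.trans (map_zero _).symm)
    exact hp0 (by rw [eq_C_of_natDegree_eq_zero h, this, C_0])
  have hd0 : derivative p ≠ 0 := fun h => hpos (derivative_eq_zero.mp h)
  have hne : aeval φ (derivative p) ≠ 0 := fun h =>
    absurd (hmin _ hd0 h) (not_le.mpr (natDegree_derivative_lt hpos))
  obtain ⟨s, hs, h⟩ := key p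
  rw [hp, map_zero] at h
  refine IsAlgebraic.of_mul (mem_nonZeroDivisors_of_ne_zero hne)
    (?_ : IsAlgebraic A (aeval φ (derivative p))) ?_
  · exact Algebra.adjoin_le (S := Subalgebra.algebraicClosure A R)
      (Set.singleton_subset_iff.mpr hφ) (aeval_mem_adjoin_singleton A φ)
  · rw [show aeval φ (derivative p) * D φ = -s by linear_combination -h]
    exact hs.neg

end Algebraic

section Exponential

variable {R : Type*} [CommRing R] [Algebra ℂ R]

/-- The subalgebra of constants of a derivation. -/
def constants (D : Derivation ℂ R R) : Subalgebra ℂ R where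
  carrier := {a | D a = 0}
  mul_mem' := by
    intro a b ha hb
    simp only [Set.mem_ofPred_eq] at *
    simp [ha, hb]
  add_mem' := by
    intro a b ha hb
    simp only [Set.mem_ofPred_eq] at *
    simp [ha, hb]
  algebraMap_mem' := by intro r; simp

variable (D : Derivation ℂ R R)

theorem constants_aeval (η : R) (p : (constants D)[X]) :
    D (aeval η p) = aeval η (derivative p) * D η := by
  induction p using Polynomial.induction_on' with
  | add p q hp hq => simp only [map_add, hp, hq]; ring
  | monomial n a =>
    have ha : D (algebraMap (constants D) R a) = 0 := a.2
    simp only [aeval_monomial, derivative_monomial, Derivation.leibniz, Derivation.leibniz_pow,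
      smul_eq_mul, nsmul_eq_mul, map_mul, map_natCast, ha]
    ring

variable [IsDomain R]

instance : CharZero (constants D) :=
  charZero_of_injective_algebraMap (algebraMap ℂ (constants D)).injective

/-- Differentiating `p(η) = 0` gives `p'(η) D η = 0`, so induction on the degree applies to `p'`. -/
theorem transcendental_constants {η : R} (hη : D η ≠ 0) {p : (constants D)[X]}
    (hp : aeval η p = 0) : p = 0 := by
  induction hn : p.natDegree using Nat.strong_induction_on generalizing p with
  | _ n ih =>
    by_cases h0 : p.natDegree = 0
    · rw [eq_C_of_natDegree_eq_zero h0, aeval_C] at hp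
      rw [eq_C_of_natDegree_eq_zero h0, show p.coeff 0 = 0 from Subtype.val_injective hp, C_0]
    · have h1 : aeval η (derivative p) = 0 := by
        have := constants_aeval D η p
        rw [hp, map_zero] at this
        exact (mul_eq_zero.mp this.symm).resolve_right hη
      exact absurd (derivative_eq_zero.mp
        (ih _ (hn ▸ natDegree_derivative_lt h0) h1 rfl)) h0

theorem eq_zero_of_derivative_eq_mul {K : Type*} [CommRing K] [IsDomain K] {q : K[X]} {c : K}
    (hc : c ≠ 0) (h : derivative q + C c * q = 0) : q = 0 := by
  by_contra hq
  have h1 : derivative q = C (-c) * q := by rw [C_neg]; linear_combination h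
  have h2 : (derivative q).degree = q.degree := by
    rw [h1, degree_C_mul (neg_ne_zero.mpr hc)]
  exact absurd h2 (degree_derivative_lt hq).ne

/-- With `η` for the inner variable and `w` for the outer one, a relation of lexicographically least
(outer degree, degree of the leading coefficient) is differentiated. The derivation acts on the
coefficient `q_l` of `w^l` as `q_l ↦ q_l' + l q_l`, up to the factor `D η`. -/
theorem exponential_transcendental {η w : R} (hη : D η ≠ 0) (hw : w ≠ 0) (hexp : D w = w * D η)
    (Q : (constants D)[X][X]) (hQ : eval₂ (aeval η).toRingHom w Q = 0) : Q = 0 := by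
  by_contra hQ0
  obtain ⟨Q, ⟨hQ0, hQ⟩, hmin⟩ := (InvImage.wf (fun Q : (constants D)[X][X] =>
      toLex (Q.natDegree, Q.leadingCoeff.natDegree)) wellFounded_lt).has_min
    {Q | Q ≠ 0 ∧ eval₂ (aeval η).toRingHom w Q = 0} ⟨Q, hQ0, hQ⟩
  set N := Q.natDegree with hN
  -- Subtracting `N D η` times the relation turns the leading coefficient into its derivative, so
  -- `T` is smaller than `Q` and must vanish. The equations `q_l' = (N - l) q_l` then leave only the
  -- term `l = N`.
  set T : (constants D)[X][X] := ∑ l ∈ Finset.range (N + 1),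
    monomial l (derivative (Q.coeff l) + C ((l : constants D) - N) * Q.coeff l) with hT
  have hTc : ∀ l, T.coeff l = derivative (Q.coeff l) + C ((l : constants D) - N) * Q.coeff l := by
    intro l
    simp only [hT, finsetSum_coeff, coeff_monomial, Finset.sum_ite_eq', Finset.mem_range]
    split_ifs with h
    · rfl
    · rw [coeff_eq_zero_of_natDegree_lt (by omega)]; simp
  have hTe : eval₂ (aeval η).toRingHom w T = 0 := by
    have h1 : D (eval₂ (aeval η).toRingHom w Q) - N * D η * eval₂ (aeval η).toRingHom w Q =
        eval₂ (aeval η).toRingHom w T * D η := by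
      rw [eval₂_eq_sum_range, hT, eval₂_finsetSum, map_sum, Finset.mul_sum, Finset.sum_mul,
        ← Finset.sum_sub_distrib]
      refine Finset.sum_congr rfl fun l _ => ?_
      have h2 := constants_aeval D η (Q.coeff l)
      rw [eval₂_monomial]
      simp only [AlgHom.toRingHom_eq_coe, RingHom.coe_coe, Derivation.leibniz,
        Derivation.leibniz_pow, smul_eq_mul, nsmul_eq_mul, h2, hexp, map_add,
        map_mul, map_sub, map_natCast]
      rcases l with _ | l
      · simp; ring
      · simp only [Nat.add_sub_cancel]; push_cast; ring
    rw [hQ, map_zero, mul_zero, sub_zero] at h1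
    exact (mul_eq_zero.mp h1.symm).resolve_right hη
  have hT0 : T = 0 := by
    by_contra hT0
    refine hmin T ⟨hT0, hTe⟩ ?_
    have hle : T.natDegree ≤ N := natDegree_le_iff_coeff_eq_zero.mpr fun l hl => by
      rw [hTc, coeff_eq_zero_of_natDegree_lt (by omega)]; simp
    show toLex (T.natDegree, T.leadingCoeff.natDegree) < toLex (N, Q.leadingCoeff.natDegree)
    rw [Prod.Lex.toLex_lt_toLex]
    rcases hle.lt_or_eq with h | h
    · exact Or.inl h
    · have h3 : T.leadingCoeff = derivative Q.leadingCoeff := by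
        rw [leadingCoeff, h, hTc]; simp [N]
      refine Or.inr ⟨h, ?_⟩
      show T.leadingCoeff.natDegree < Q.leadingCoeff.natDegree
      rw [h3]
      refine natDegree_derivative_lt fun h4 => ?_
      have h5 : T.leadingCoeff = 0 := by
        rw [h3, eq_C_of_natDegree_eq_zero h4, derivative_C]
      exact hT0 (leadingCoeff_eq_zero.mp h5)
  have hlow : ∀ l, l ≠ N → Q.coeff l = 0 := fun l hl => by
    refine eq_zero_of_derivative_eq_mul (c := (l : constants D) - N)
      (sub_ne_zero.mpr (by exact_mod_cast hl)) ?_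
    rw [← hTc, hT0, coeff_zero]
  have hQm : Q = monomial N Q.leadingCoeff := by
    ext1 l
    rw [coeff_monomial]
    split_ifs with h
    · rw [← h]; rfl
    · exact hlow l (Ne.symm h)
  rw [hQm, eval₂_monomial] at hQ
  exact hQ0 (leadingCoeff_eq_zero.mp
    (transcendental_constants D hη ((mul_eq_zero.mp hQ).resolve_right (pow_ne_zero _ hw))))

/-- If `D η ≠ 0`, then `η` is transcendental over the constants. Since `η` is algebraic over the
constants and `z`, the exchange property makes `z`, and with it `w`, algebraic over the constants
and `η`, against `exponential_transcendental`. -/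
theorem derivation_eq_zero_of_exp_isAlgebraic {z η w : R} (hw : w ≠ 0) (hexp : D w = w * D η)
    (hηa : IsAlgebraic (Algebra.adjoin (constants D) {z}) η)
    (hwa : IsAlgebraic (Algebra.adjoin (constants D) {z}) w) : D η = 0 := by
  by_contra hη
  have hcl : ∀ (s : Set R) (a : R),
      a ∈ (AlgebraicIndependent.matroid (constants D) R).closure s ↔
        IsAlgebraic (Algebra.adjoin (constants D) s) a := by
    intro s a
    rw [AlgebraicIndependent.matroid_closure_eq]
    rfl
  have h1 : η ∉ (AlgebraicIndependent.matroid (constants D) R).closure ∅ := by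
    rw [hcl]
    intro h
    have h2 : IsAlgebraic (constants D) η := by
      rw [Algebra.adjoin_empty] at h
      exact Subalgebra.isAlgebraic_of_isAlgebraic_bot h
    obtain ⟨p, hp0, hp⟩ := h2
    exact hp0 (transcendental_constants D hη hp)
  have h2 : z ∈ (AlgebraicIndependent.matroid (constants D) R).closure {η} := by
    have := Matroid.closure_exchange (M := AlgebraicIndependent.matroid (constants D) R)
      (X := ∅) (e := η) (f := z) ⟨by simpa [hcl] using hηa, h1⟩
    simpa using this.1
  have h3 : w ∈ (AlgebraicIndependent.matroid (constants D) R).closure {η} := by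
    have h4 := (hcl {z} w).mpr hwa
    exact Matroid.closure_subset_closure_of_subset_closure (by simpa using h2) h4
  rw [hcl] at h3
  obtain ⟨P, hP0, hP⟩ := h3
  have hmem : η ∈ Algebra.adjoin (constants D) {η} := Algebra.self_mem_adjoin_singleton _ _
  set f : (constants D)[X] →ₐ[constants D] Algebra.adjoin (constants D) {η} := aeval ⟨η, hmem⟩
  have hf : ∀ p, (f p : R) = aeval η p := fun p => aeval_subalgebra_coe p _ ⟨η, hmem⟩
  have hsurj : Function.Surjective f := fun a => by
    obtain ⟨p, hp⟩ := (Algebra.adjoin_singleton_eq_range_aeval (constants D) η).le a.2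
    exact ⟨p, Subtype.val_injective ((hf p).trans hp)⟩
  obtain ⟨Q, hQ⟩ := map_surjective f.toRingHom hsurj P
  refine hP0 ?_
  rw [← hQ, exponential_transcendental D hη hw hexp Q ?_, Polynomial.map_zero]
  rw [← hQ, aeval_def, eval₂_map] at hP
  rw [← hP]
  congr 1
  ext p
  · exact (hf _).symm
  · exact (hf _).symm

end Exponential

end ExponentialTranscendence

/-! ### The functions `ψ` as formal primitives evaluated at a root. -/

section LogarithmicRoots

open Polynomial

section Weighted

variable {R : Type*} [CommRing R]

/-- The linear functional on `R[X]` with value `w n` at `X ^ n`. -/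
def weighted (w : ℕ → R) : R[X] →ₗ[R] R :=
  Polynomial.lsum fun n => LinearMap.toSpanSingleton R R (w n)

@[simp]
theorem weighted_monomial (w : ℕ → R) (n : ℕ) (c : R) :
    weighted w (monomial n c) = c * w n := by
  simp [weighted, Polynomial.lsum_apply, sum_monomial_index]

theorem weighted_eq_sum (w : ℕ → R) (p : R[X]) {N : ℕ} (hN : p.natDegree < N) :
    weighted w p = ∑ n ∈ Finset.range N, p.coeff n * w n := by
  conv_lhs => rw [p.as_sum_range' N hN]
  simp

theorem weighted_X_pow_mul (w : ℕ → R) (k : ℕ) (p : R[X]) :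
    weighted w (X ^ k * p) = weighted (fun n => w (n + k)) p := by
  induction p using Polynomial.induction_on' with
  | add p q hp hq => simp only [map_add, mul_add, hp, hq]
  | monomial n c => simp [X_pow_mul_monomial]

theorem weighted_mul_pow (r c : R) (p : R[X]) :
    weighted (fun n => r ^ n * c) p = p.eval r * c := by
  induction p using Polynomial.induction_on' with
  | add p q hp hq => simp only [map_add, eval_add, add_mul, hp, hq]
  | monomial n a => simp; ring

variable [Algebra ℂ R]

/-- The derivation of `R[X]` that applies `D` to the coefficients. -/
def coeffDerivation (D : Derivation ℂ R R) : Derivation ℂ R[X] R[X] :=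
  PolynomialModule.equivPolynomialSelf.compDer D.mapCoeffs

@[simp]
theorem coeffDerivation_coeff (D : Derivation ℂ R R) (p : R[X]) (n : ℕ) :
    (coeffDerivation D p).coeff n = D (p.coeff n) := rfl

@[simp]
theorem coeffDerivation_monomial (D : Derivation ℂ R R) (n : ℕ) (c : R) :
    coeffDerivation D (monomial n c) = monomial n (D c) := by
  ext l
  simp [coeff_monomial, apply_ite D]

@[simp]
theorem coeffDerivation_X (D : Derivation ℂ R R) : coeffDerivation D X = 0 := by
  rw [← monomial_one_one_eq_X]; simp

@[simp]
theorem coeffDerivation_C (D : Derivation ℂ R R) (c : R) :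
    coeffDerivation D (C c) = C (D c) := by
  rw [← monomial_zero_left, coeffDerivation_monomial, monomial_zero_left]

theorem derivation_weighted (D : Derivation ℂ R R) (w : ℕ → R) (p : R[X]) :
    D (weighted w p) = weighted w (coeffDerivation D p) + weighted (fun n => D (w n)) p := by
  induction p using Polynomial.induction_on' with
  | add p q hp hq => simp only [map_add, hp, hq]; ring
  | monomial n c => simp; ring

end Weighted

/-- Commuting derivations `D i = ∂/∂x_i` of a `ℂ`-algebra together with coordinates `x i`. -/
structure Coordinates (m : ℕ) (R : Type*) [CommRing R] [Algebra ℂ R] where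
  D : Fin (m + 2) → Derivation ℂ R R
  x : Fin (m + 2) → R
  comm : ∀ i j a, D i (D j a) = D j (D i a)
  D_x : ∀ i j, D i (x j) = if i = j then 1 else 0

variable {m : ℕ} {R : Type*} [CommRing R] [Algebra ℂ R]

/-- The polynomial `∑ x_j t^{k_j}` over `R`. -/
def Coordinates.poly (c : Coordinates m R) (k : Fin (m + 2) → ℕ) : R[X] :=
  ∑ j, monomial (k j) (c.x j)

/-- The scaled power `f ^ n / n!`. -/
def Coordinates.divPow (c : Coordinates m R) (k : Fin (m + 2) → ℕ) (n : ℕ) : R[X] :=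
  C (algebraMap ℂ R (n.factorial : ℂ)⁻¹) * c.poly k ^ n

namespace Coordinates

variable (c : Coordinates m R) (k : Fin (m + 2) → ℕ)

theorem coeffDerivation_poly (i : Fin (m + 2)) :
    coeffDerivation (c.D i) (c.poly k) = X ^ k i := by
  simp [poly, c.D_x, apply_ite, ← X_pow_eq_monomial]

theorem algebraMap_factorial (n : ℕ) :
    algebraMap ℂ R ((n + 1).factorial : ℂ)⁻¹ * (n + 1) = algebraMap ℂ R (n.factorial : ℂ)⁻¹ := by
  rw [← Nat.cast_succ, ← map_natCast (algebraMap ℂ R), ← map_mul]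
  congr 1
  rw [Nat.factorial_succ]
  have h1 : ((n + 1 : ℕ) : ℂ) ≠ 0 := by exact_mod_cast n.succ_ne_zero
  have h2 : (n.factorial : ℂ) ≠ 0 := by exact_mod_cast n.factorial_ne_zero
  push_cast at *
  field_simp

@[simp]
theorem divPow_zero : c.divPow k 0 = 1 := by simp [divPow]

theorem divPow_succ (n : ℕ) :
    c.divPow k n * c.poly k = (n + 1) * c.divPow k (n + 1) := by
  rw [divPow, divPow, ← algebraMap_factorial n, C_mul, pow_succ]
  simp
  ring

theorem coeffDerivation_divPow_succ (i : Fin (m + 2)) (n : ℕ) :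
    coeffDerivation (c.D i) (c.divPow k (n + 1)) = X ^ k i * c.divPow k n := by
  rw [divPow, divPow, ← algebraMap_factorial n, C_mul, Derivation.leibniz, Derivation.leibniz_pow,
    coeffDerivation_poly, coeffDerivation_C, Derivation.map_algebraMap]
  simp
  ring

theorem derivative_divPow_succ (n : ℕ) :
    derivative (c.divPow k (n + 1)) = derivative (c.poly k) * c.divPow k n := by
  rw [divPow, divPow, ← algebraMap_factorial n, C_mul, derivative_C_mul, derivative_pow]
  simp
  ring

theorem X_mul_derivative_poly :
    X * derivative (c.poly k) = ∑ j, C ((k j : R) * c.x j) * X ^ k j := by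
  rw [poly, derivative_sum, Finset.mul_sum]
  refine Finset.sum_congr rfl fun j _ => ?_
  rw [derivative_monomial, C_mul_X_pow_eq_monomial]
  rcases h : k j with _ | n
  · simp
  · simp [X_mul_monomial, mul_comm]

theorem poly_eq_sum : c.poly k = ∑ j, C (c.x j) * X ^ k j := by
  simp [poly, C_mul_X_pow_eq_monomial]

end Coordinates

/-- A unit root of the polynomial `∑ x_j t^{k_j}` with its logarithm and the value there of the
derivative of the polynomial, which is a unit as well. -/
structure LogRoot (c : Coordinates m R) (k : Fin (m + 2) → ℕ) where
  root : Rˣ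
  der : Rˣ
  log : R
  isRoot : ∑ j, c.x j * (root : R) ^ k j = 0
  der_eq : ∑ j, (k j : R) * c.x j * (root : R) ^ k j = root * der
  D_log : ∀ i, root * c.D i log = c.D i root

namespace LogRoot

variable {c : Coordinates m R} {k : Fin (m + 2) → ℕ} (ρ : LogRoot c k)

theorem eval_poly : (c.poly k).eval (ρ.root : R) = 0 := by
  simp [Coordinates.poly, eval_finsetSum, ρ.isRoot]

theorem D_root (i : Fin (m + 2)) : c.D i ρ.root = -(ρ.root : R) ^ k i * (ρ.der⁻¹ : Rˣ) := by
  have h := congrArg (c.D i) ρ.isRoot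
  rw [map_sum, map_zero] at h
  have h1 : ∀ j, (ρ.root : R) * c.D i (c.x j * (ρ.root : R) ^ k j) =
      ρ.root * ((ρ.root : R) ^ k j * if i = j then 1 else 0) +
        (k j : R) * c.x j * (ρ.root : R) ^ k j * c.D i ρ.root := by
    intro j
    rw [Derivation.leibniz, Derivation.leibniz_pow, c.D_x]
    rcases h : k j with _ | n
    · simp
    · simp only [Nat.add_sub_cancel, smul_eq_mul, nsmul_eq_mul]; ring
  have h2 : (ρ.root : R) * ((ρ.root : R) ^ k i + ρ.der * c.D i ρ.root) = 0 := by
    have := congrArg ((ρ.root : R) * ·) h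
    simp only [mul_zero, Finset.mul_sum, h1, Finset.sum_add_distrib, ← Finset.sum_mul,
      ρ.der_eq] at this
    simp at this
    linear_combination this
  have h3 : (ρ.root : R) ^ k i + ρ.der * c.D i ρ.root = 0 := by
    simpa using h2
  linear_combination (ρ.der⁻¹ : Rˣ) * h3 - c.D i ρ.root * ρ.der.inv_mul

theorem D_log_eq (i : Fin (m + 2)) :
    c.D i ρ.log = -((ρ.root ^ ((k i : ℤ) - 1) * ρ.der⁻¹ : Rˣ) : R) := by
  have h := ρ.D_log i
  rw [ρ.D_root] at h
  rw [zpow_sub_one, zpow_natCast]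
  push_cast
  linear_combination (ρ.root⁻¹ : Rˣ) * h - c.D i ρ.log * ρ.root.inv_mul

theorem D_zpow (i : Fin (m + 2)) (n : ℤ) :
    c.D i (ρ.root ^ n : Rˣ) = n * (ρ.root ^ n : Rˣ) * c.D i ρ.log := by
  have hs : ∀ n : ℤ, c.D i (ρ.root ^ (n + 1) : Rˣ) =
      ρ.root * (c.D i (ρ.root ^ n : Rˣ) + (ρ.root ^ n : Rˣ) * c.D i ρ.log) := by
    intro n
    rw [zpow_add_one, Units.val_mul, Derivation.leibniz, ← ρ.D_log]
    simp only [smul_eq_mul]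
    ring
  induction n using Int.induction_on with
  | zero => simp
  | succ n ih => rw [hs, ih, zpow_add_one]; push_cast; ring
  | pred n ih =>
    have h := hs (-n - 1)
    rw [sub_add_cancel, ih] at h
    have h1 : (ρ.root ^ (-n : ℤ) : Rˣ) = ρ.root ^ (-n - 1 : ℤ) * ρ.root := by
      rw [← zpow_add_one, sub_add_cancel]
    rw [h1] at h
    have h2 : (ρ.root : R) * (c.D i (ρ.root ^ (-n - 1 : ℤ) : Rˣ) - ((-n - 1 : ℤ) : R) *
        (ρ.root ^ (-n - 1 : ℤ) : Rˣ) * c.D i ρ.log) = 0 := by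
      push_cast at h ⊢
      linear_combination -h
    exact sub_eq_zero.mp (by simpa using h2)

/-- The primitive of `t ^ (l - a - 1)` without constant term, at the root. -/
def primWeight (a : ℤ) (l : ℕ) : R :=
  if (l : ℤ) = a then ρ.log
  else algebraMap ℂ R (((l : ℤ) - a : ℤ) : ℂ)⁻¹ * (ρ.root ^ ((l : ℤ) - a) : Rˣ)

theorem algebraMap_inv_sub_mul {n a : ℤ} (h : n ≠ a) :
    algebraMap ℂ R ((n - a : ℤ) : ℂ)⁻¹ * ((n - a : ℤ) : R) = 1 := by
  rw [← map_intCast (algebraMap ℂ R), ← map_mul, inv_mul_cancel₀, map_one]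
  exact_mod_cast sub_ne_zero.mpr h

theorem D_primWeight (i : Fin (m + 2)) (a : ℤ) (l : ℕ) :
    c.D i (ρ.primWeight a l) = (ρ.root ^ ((l : ℤ) - a) : Rˣ) * c.D i ρ.log := by
  rw [primWeight]
  split_ifs with h
  · simp [h]
  · rw [Derivation.leibniz, ρ.D_zpow, Derivation.map_algebraMap]
    have h1 := algebraMap_inv_sub_mul (R := R) h
    simp only [smul_eq_mul, mul_zero, add_zero]
    linear_combination (ρ.root ^ ((l : ℤ) - a) : Rˣ) * c.D i ρ.log * h1

/-- The primitive of `t ^ (- a - 1) p(t)` without constant term, at the root. -/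
def prim (a : ℤ) : R[X] →ₗ[R] R := weighted (ρ.primWeight a)

/-- The rule for differentiating an integral with a variable endpoint: the integrand is
differentiated, and the endpoint contributes its value at the root. -/
theorem D_prim (i : Fin (m + 2)) (a : ℤ) (p : R[X]) :
    c.D i (ρ.prim a p) = ρ.prim a (coeffDerivation (c.D i) p) +
      p.eval (ρ.root : R) * ((ρ.root ^ (-a) : Rˣ) * c.D i ρ.log) := by
  rw [prim, derivation_weighted, ← weighted_mul_pow]
  congr 3
  ext n
  rw [D_primWeight, sub_eq_add_neg, zpow_add, zpow_natCast]
  push_cast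
  ring

theorem prim_X_pow_mul (a : ℤ) (n : ℕ) (p : R[X]) :
    ρ.prim a (X ^ n * p) = ρ.prim (a - n) p := by
  rw [prim, weighted_X_pow_mul, prim]
  congr 2
  ext l
  have h1 : (((l + n : ℕ) : ℤ) = a) = ((l : ℤ) = a - n) := by
    apply propext; push_cast; constructor <;> intro h <;> linarith
  have h2 : ((l + n : ℕ) : ℤ) - a = l - (a - n) := by push_cast; ring
  simp only [primWeight, h1, h2]

/-- Integration by parts against `t^(-a)`. The primitive of the derivative of `t^(-a) p` has its
constant term dropped, and this constant is the coefficient of `t^a` in `p`; the case distinction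
guards against `toNat` for negative `a`. -/
theorem prim_X_mul_derivative (a : ℤ) (p : R[X]) :
    ρ.prim a (X * derivative p) = p.eval (ρ.root : R) * (ρ.root ^ (-a) : Rˣ)
      - (if 0 ≤ a then p.coeff a.toNat else 0) + a * ρ.prim a p := by
  induction p using Polynomial.induction_on' with
  | add p q hp hq =>
    simp only [mul_add, map_add, eval_add, coeff_add, hp, hq]
    split_ifs <;> ring
  | monomial n b =>
    have h0 : X * derivative (monomial n b) = monomial n (b * n) := by
      rw [derivative_monomial]
      rcases n with _ | n
      · simp
      · simp [X_mul_monomial]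
    have h2 : ((ρ.root ^ ((n : ℤ) - a) : Rˣ) : R) = (ρ.root : R) ^ n * (ρ.root ^ (-a) : Rˣ) := by
      rw [sub_eq_add_neg, zpow_add, zpow_natCast]; push_cast; rfl
    rw [h0, prim, weighted_monomial, weighted_monomial, primWeight, eval_monomial, coeff_monomial]
    by_cases h : (n : ℤ) = a
    · subst h
      have h3 : (ρ.root : R) ^ n * (ρ.root ^ (-(n : ℤ)) : Rˣ) = 1 := by
        rw [zpow_neg, zpow_natCast]
        exact_mod_cast (ρ.root ^ n).mul_inv
      simp only [if_true, Int.toNat_natCast, Int.natCast_nonneg]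
      push_cast
      linear_combination -b * h3
    · have h4 : (if 0 ≤ a then (if n = a.toNat then b else 0) else 0) = 0 := by
        split_ifs <;> first | rfl | omega
      have h1 := algebraMap_inv_sub_mul (R := R) h
      have h5 : (((n : ℤ) - a : ℤ) : R) = (n : R) - a := by push_cast; rfl
      rw [h5] at h1
      rw [h2, h4, if_neg h]
      linear_combination b * (ρ.root : R) ^ n * (ρ.root ^ (-a) : Rˣ) * h1

/-- `ψ(n, a)` for `n : ℕ`. -/
def psiNat (n : ℕ) (a : ℤ) : R := ρ.prim a (c.divPow k n)

theorem D_psiNat_succ (i : Fin (m + 2)) (n : ℕ) (a : ℤ) :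
    c.D i (ρ.psiNat (n + 1) a) = ρ.psiNat n (a - k i) := by
  have h : (c.divPow k (n + 1)).eval (ρ.root : R) = 0 := by
    simp [Coordinates.divPow, ρ.eval_poly]
  rw [psiNat, D_prim, c.coeffDerivation_divPow_succ, prim_X_pow_mul, h, zero_mul, add_zero, psiNat]

theorem psiNat_zero (a : ℤ) : ρ.psiNat 0 a = ρ.primWeight a 0 := by
  rw [psiNat, Coordinates.divPow_zero, prim, ← monomial_zero_one, weighted_monomial, one_mul]

theorem D_psiNat_zero (i : Fin (m + 2)) (a : ℤ) :
    c.D i (ρ.psiNat 0 a) = -((ρ.root ^ ((k i : ℤ) - a - 1) * ρ.der⁻¹ : Rˣ) : R) := by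
  rw [psiNat_zero, D_primWeight, ρ.D_log_eq, mul_neg, ← Units.val_mul, ← mul_assoc, ← zpow_add]
  congr 4
  push_cast
  ring

/-- The functions `ψ(n, a)` for `n : ℤ`. -/
def psi (n a : ℤ) : R :=
  if 0 ≤ n then ρ.psiNat n.toNat a else (c.D 0)^[(-n).toNat] (ρ.psiNat 0 a)

theorem psi_natCast (n : ℕ) (a : ℤ) : ρ.psi n a = ρ.psiNat n a := by simp [psi]

theorem psi_neg (n : ℕ) (a : ℤ) : ρ.psi (-n) a = (c.D 0)^[n] (ρ.psiNat 0 a) := by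
  rcases n with _ | n
  · simp [psi]
  · rw [psi, if_neg (by push_cast; omega)]; simp

theorem psi_neg_one (a : ℤ) (hk : k 0 = 0) :
    ρ.psi (-1) a = -((ρ.root ^ (- a - 1) * ρ.der⁻¹ : Rˣ) : R) := by
  have := ρ.psi_neg 1 a
  rw [Function.iterate_one, D_psiNat_zero, hk] at this
  simpa using this

/-- This is what allows negative degrees to be reached with `D 0` alone while every `D i` obeys the
shift rule. -/
theorem D_psiNat_zero_eq (i : Fin (m + 2)) (a : ℤ) (hk : k 0 = 0) :
    c.D i (ρ.psiNat 0 a) = c.D 0 (ρ.psiNat 0 (a - k i)) := by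
  rw [D_psiNat_zero, D_psiNat_zero, hk]
  congr 4
  push_cast
  ring

end LogRoot

theorem Coordinates.D_iterate_comm (c : Coordinates m R) (i j : Fin (m + 2)) (n : ℕ) (a : R) :
    c.D i ((c.D j)^[n] a) = (c.D j)^[n] (c.D i a) :=
  Function.Commute.iterate_right (f := c.D i) (g := c.D j) (fun a => c.comm i j a) n a

namespace LogRoot

variable {c : Coordinates m R} {k : Fin (m + 2) → ℕ} (ρ : LogRoot c k)

theorem D_psi (hk : k 0 = 0) (i : Fin (m + 2)) (n a : ℤ) :
    c.D i (ρ.psi n a) = ρ.psi (n - 1) (a - k i) := by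
  obtain ⟨n, rfl | rfl⟩ := n.eq_nat_or_neg
  · rcases n with _ | n
    · have h1 := ρ.psi_neg 1 (a - k i)
      rw [Function.iterate_one] at h1
      rw [psi_natCast, D_psiNat_zero_eq _ _ _ hk, ← h1]
      simp
    · rw [psi_natCast, D_psiNat_succ, ← psi_natCast]
      simp
  · rw [psi_neg, c.D_iterate_comm, D_psiNat_zero_eq _ _ _ hk, ← Function.iterate_succ_apply,
      ← psi_neg]
    congr 1
    push_cast
    ring

/-- The coefficient of `t ^ a` in `f ^ n / n!`. -/
def _root_.MonomialCurve.Coordinates.phi (c : Coordinates m R) (k : Fin (m + 2) → ℕ) (n a : ℤ) :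
    R :=
  if 0 ≤ n ∧ 0 ≤ a then (c.divPow k n.toNat).coeff a.toNat else 0

/-- In positive degree this is `f · f^n / n! = (n+1) f^(n+1) / (n+1)!` under the primitive, and in
degree zero it is `f(ρ) = 0`. Negative degrees follow by applying `D 0`, where `D 0 (x 0) = 1`
produces the change of `n`. -/
theorem sum_x_mul_psi (hk : k 0 = 0) (n a : ℤ) :
    ∑ i, c.x i * ρ.psi (n - 1) (a - k i) = n * ρ.psi n a := by
  obtain ⟨n, rfl | rfl⟩ := n.eq_nat_or_neg
  · rcases n with _ | n
    · have h : ∀ i, c.x i * ρ.psi (((0 : ℕ) : ℤ) - 1) (a - k i) =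
          c.x i * (ρ.root : R) ^ k i * -((ρ.root ^ (- a - 1) * ρ.der⁻¹ : Rˣ) : R) := by
        intro i
        rw [Nat.cast_zero, zero_sub, psi_neg_one _ _ hk,
          show -(a - (k i : ℤ)) - 1 = k i + (-a - 1) by ring, zpow_add, zpow_natCast]
        push_cast
        ring
      simp only [h, ← Finset.sum_mul, ρ.isRoot]
      simp
    · have h : ∀ i, c.x i * ρ.psi (((n + 1 : ℕ) : ℤ) - 1) (a - k i) =
          ρ.prim a (c.x i • (X ^ k i * c.divPow k n)) := by
        intro i
        rw [Nat.cast_succ, add_sub_cancel_right, psi_natCast, map_smul, prim_X_pow_mul, smul_eq_mul,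
          psiNat]
      have h2 : ∑ i, c.x i • (X ^ k i * c.divPow k n) = ((n : R) + 1) • c.divPow k (n + 1) := by
        rw [smul_eq_C_mul, C_add, C_1, map_natCast, ← c.divPow_succ, c.poly_eq_sum, Finset.mul_sum]
        refine Finset.sum_congr rfl fun i _ => ?_
        rw [smul_eq_C_mul]; ring
      simp only [h]
      rw [← map_sum, h2, map_smul, psi_natCast, psiNat]
      simp
  · induction n with
    | zero =>
      have h : ∀ i, c.x i * ρ.psi (-((0 : ℕ) : ℤ) - 1) (a - k i) =
          c.x i * (ρ.root : R) ^ k i * -((ρ.root ^ (- a - 1) * ρ.der⁻¹ : Rˣ) : R) := by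
        intro i
        rw [Nat.cast_zero, neg_zero, zero_sub, psi_neg_one _ _ hk,
          show -(a - (k i : ℤ)) - 1 = k i + (-a - 1) by ring, zpow_add, zpow_natCast]
        push_cast
        ring
      simp only [h, ← Finset.sum_mul, ρ.isRoot]
      simp
    | succ n ih =>
      have h := congrArg (c.D 0) ih
      simp only [map_sum, Derivation.leibniz, ρ.D_psi hk, hk, c.D_x, smul_eq_mul,
        Finset.sum_add_distrib, Derivation.map_intCast] at h
      simp [hk] at h
      have e : (-(n : ℤ) - 1) = -((n + 1 : ℕ) : ℤ) := by push_cast; ring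
      rw [e] at h
      push_cast at h ⊢
      linear_combination h

theorem D_zero_phi_neg (n : ℕ) (a : ℤ) (i : Fin (m + 2)) : c.D i (c.phi k (-n) a) = 0 := by
  rcases n with _ | n
  · simp only [Coordinates.phi]
    split_ifs <;> simp [coeff_one, apply_ite (c.D i)]
  · rw [Coordinates.phi, if_neg (by push_cast; omega), map_zero]

/-- Here `t f'` replaces `f`: integration by parts gives the factor `a`, and the dropped constant
term is `phi`. Since `phi` is constant in degree zero and vanishes below, `D 0` again carries the
identity downwards. -/
theorem sum_k_mul_x_mul_psi (hk : k 0 = 0) (n a : ℤ) :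
    ∑ i, (k i : R) * c.x i * ρ.psi (n - 1) (a - k i) = a * ρ.psi n a - c.phi k n a := by
  have h0 : ∑ i, (k i : R) * c.x i * ρ.psi ((0 : ℤ) - 1) (a - k i) =
      a * ρ.psi 0 a - c.phi k 0 a := by
    have h : ∀ i, (k i : R) * c.x i * ρ.psi ((0 : ℤ) - 1) (a - k i) =
        (k i : R) * c.x i * (ρ.root : R) ^ k i *
          -((ρ.root ^ (- a - 1) * ρ.der⁻¹ : Rˣ) : R) := by
      intro i
      rw [zero_sub, psi_neg_one _ _ hk,
        show -(a - (k i : ℤ)) - 1 = k i + (-a - 1) by ring, zpow_add, zpow_natCast]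
      push_cast
      ring
    have h1 : ρ.psi 0 a = ρ.primWeight a 0 := by
      rw [← psiNat_zero, ← psi_natCast, Nat.cast_zero]
    have h2 : (ρ.root : R) * ρ.der * -((ρ.root ^ (- a - 1) * ρ.der⁻¹ : Rˣ) : R) =
        -(ρ.root ^ (-a) : Rˣ) := by
      rw [zpow_sub_one]
      push_cast
      linear_combination (-(ρ.root ^ (-a) : Rˣ) : R) *
        (ρ.root.mul_inv * ρ.der * (ρ.der⁻¹ : Rˣ) + ρ.der.mul_inv)
    simp only [h, ← Finset.sum_mul, ρ.der_eq, h2, h1, primWeight, Coordinates.phi]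
    by_cases ha : a = 0
    · subst ha
      simp
    · have h3 := algebraMap_inv_sub_mul (R := R) (Ne.symm ha)
      have h4 : (if 0 ≤ (0 : ℤ) ∧ 0 ≤ a then (c.divPow k (0 : ℤ).toNat).coeff a.toNat else 0)
          = 0 := by
        split_ifs with h5
        · simp [coeff_one, show ¬ a ≤ 0 by omega]
        · rfl
      rw [if_neg (by simpa using Ne.symm ha), h4]
      simp only [Nat.cast_zero, zero_sub] at h3 ⊢
      push_cast at h3 ⊢
      linear_combination ((ρ.root ^ (-a) : Rˣ) : R) * h3
  obtain ⟨n, rfl | rfl⟩ := n.eq_nat_or_neg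
  · rcases n with _ | n
    · exact h0
    · have h : ∀ i, (k i : R) * c.x i * ρ.psi (((n + 1 : ℕ) : ℤ) - 1) (a - k i) =
          ρ.prim a (((k i : R) * c.x i) • (X ^ k i * c.divPow k n)) := by
        intro i
        rw [Nat.cast_succ, add_sub_cancel_right, psi_natCast, map_smul, prim_X_pow_mul, smul_eq_mul,
          psiNat]
      have h2 : ∑ i, ((k i : R) * c.x i) • (X ^ k i * c.divPow k n) =
          X * derivative (c.divPow k (n + 1)) := by
        rw [c.derivative_divPow_succ, ← mul_assoc, c.X_mul_derivative_poly, Finset.sum_mul]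
        refine Finset.sum_congr rfl fun i _ => ?_
        rw [smul_eq_C_mul]; ring
      have h3 : (c.divPow k (n + 1)).eval (ρ.root : R) = 0 := by
        simp [Coordinates.divPow, ρ.eval_poly]
      simp only [h]
      rw [← map_sum, h2, psi_natCast, psiNat, prim_X_mul_derivative, h3, Coordinates.phi]
      simp only [Int.natCast_nonneg, true_and, Int.toNat_natCast]
      ring
  · induction n with
    | zero => simpa using h0
    | succ n ih =>
      have h := congrArg (c.D 0) ih
      have h' := D_zero_phi_neg (c := c) (k := k) n a 0
      rw [map_sub, h'] at h
      simp only [map_sum, Derivation.leibniz, ρ.D_psi hk, hk, c.D_x, smul_eq_mul,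
        Finset.sum_add_distrib, Derivation.map_intCast, Derivation.map_natCast] at h
      simp [hk] at h
      have e : (-(n : ℤ) - 1) = -((n + 1 : ℕ) : ℤ) := by push_cast; ring
      rw [e] at h
      rw [Coordinates.phi, if_neg (by push_cast; omega), sub_zero]
      linear_combination h

end LogRoot

end LogarithmicRoots

/-! ### Sums over all roots, their vanishing on gaps, and the function `χ`. -/

section RootSums

open Polynomial

variable {m : ℕ} {R : Type*} [CommRing R] [Algebra ℂ R]

namespace Coordinates

variable (c : Coordinates m R) (k : Fin (m + 2) → ℕ)

theorem divPow_eq_sum (n : ℕ) :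
    c.divPow k n = ∑ u ∈ Finset.piAntidiag Finset.univ n,
      monomial (∑ j, u j * k j)
        (∏ j, c.x j ^ u j * algebraMap ℂ R ((u j).factorial : ℂ)⁻¹) := by
  rw [divPow, poly, Finset.sum_pow_eq_sum_piAntidiag, Finset.mul_sum]
  refine Finset.sum_congr rfl fun u hu => ?_
  have hu' : ∑ j, u j = n := (Finset.mem_piAntidiag.mp hu).1
  have h1 : ∏ j, (monomial (k j) (c.x j)) ^ u j =
      (monomial (∑ j, u j * k j) (∏ j, c.x j ^ u j) : R[X]) := by
    simp only [monomial_pow]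
    rw [← Finset.prod_congr rfl fun j _ => C_mul_X_pow_eq_monomial, Finset.prod_mul_distrib,
      Finset.prod_pow_eq_pow_sum, ← map_prod, C_mul_X_pow_eq_monomial]
    simp only [mul_comm]
  have h2 : algebraMap ℂ R (n.factorial : ℂ)⁻¹ * (Nat.multinomial Finset.univ u : R) =
      ∏ j, algebraMap ℂ R ((u j).factorial : ℂ)⁻¹ := by
    rw [← map_natCast (algebraMap ℂ R), ← map_mul, ← map_prod]
    congr 1
    have h3 := Nat.multinomial_spec Finset.univ u
    rw [hu'] at h3
    have h4 : (n.factorial : ℂ) ≠ 0 := by exact_mod_cast n.factorial_ne_zero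
    have h5 : ((∏ j, (u j).factorial : ℕ) : ℂ) ≠ 0 := by
      exact_mod_cast Finset.prod_ne_zero_iff.mpr fun j _ => (u j).factorial_ne_zero
    rw [Finset.prod_inv_distrib, ← Nat.cast_prod]
    refine eq_inv_of_mul_eq_one_left ?_
    rw [← h3]
    push_cast at h5 ⊢
    have h6 : (Nat.multinomial Finset.univ u : ℂ) ≠ 0 := by
      intro h
      rw [← h3] at h4
      push_cast at h4
      rw [h, mul_zero] at h4
      exact h4 rfl
    field_simp
  rw [h1, Finset.prod_mul_distrib, ← h2, ← C_eq_natCast, mul_left_comm, ← mul_assoc,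
    ← C_mul, C_mul_monomial]
  congr 1
  ring

theorem exists_of_coeff_divPow_ne_zero {n l : ℕ} (h : (c.divPow k n).coeff l ≠ 0) :
    ∃ u : Fin (m + 2) → ℕ, ∑ j, u j = n ∧ ∑ j, u j * k j = l := by
  rw [divPow_eq_sum, finsetSum_coeff] at h
  obtain ⟨u, hu, h1⟩ := Finset.exists_ne_zero_of_sum_ne_zero h
  rw [coeff_monomial] at h1
  exact ⟨u, (Finset.mem_piAntidiag.mp hu).1, by by_contra h2; exact h1 (if_neg h2)⟩

theorem D_iterate_zero (i : Fin (m + 2)) (n : ℕ) : (c.D i)^[n] 0 = 0 := by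
  induction n with
  | zero => rfl
  | succ n ih => rw [Function.iterate_succ_apply', ih, map_zero]

theorem D_iterate_add (i : Fin (m + 2)) (n : ℕ) (a b : R) :
    (c.D i)^[n] (a + b) = (c.D i)^[n] a + (c.D i)^[n] b :=
  iterate_map_add (c.D i) n a b

theorem D_iterate_neg (i : Fin (m + 2)) (n : ℕ) (a : R) :
    (c.D i)^[n] (-a) = -(c.D i)^[n] a :=
  iterate_map_neg (c.D i) n a

theorem D_iterate_sum {ι : Type*} (s : Finset ι) (f : ι → R) (i : Fin (m + 2)) (n : ℕ) :
    (c.D i)^[n] (∑ j ∈ s, f j) = ∑ j ∈ s, (c.D i)^[n] (f j) := by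
  classical
  induction s using Finset.induction_on with
  | empty => simp
  | insert a s ha ih => rw [Finset.sum_insert ha, Finset.sum_insert ha, D_iterate_add, ih]

theorem D_iterate_const_mul (i : Fin (m + 2)) (n : ℕ) {z : R} (hz : c.D i z = 0) (a : R) :
    (c.D i)^[n] (z * a) = z * (c.D i)^[n] a := by
  induction n with
  | zero => rfl
  | succ n ih =>
    rw [Function.iterate_succ_apply', ih, Function.iterate_succ_apply', Derivation.leibniz, hz]
    simp

theorem D_iterate_x_mul (j i : Fin (m + 2)) (n : ℕ) (a : R) :
    (c.D j)^[n + 1] (c.x i * a) =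
      c.x i * (c.D j)^[n + 1] a + if j = i then ((n : R) + 1) * (c.D j)^[n] a else 0 := by
  induction n with
  | zero =>
    simp only [zero_add, Function.iterate_one, Derivation.leibniz, c.D_x, smul_eq_mul]
    split_ifs <;> simp
  | succ n ih =>
    rw [Function.iterate_succ_apply', ih, map_add, Derivation.leibniz, c.D_x,
      Function.iterate_succ_apply' _ (n + 1) a, apply_ite (c.D j), Derivation.leibniz]
    split_ifs with h
    · simp [← Function.iterate_succ_apply']
      ring
    · simp

end Coordinates

/-- `(n, a)` is such that `a` is not a sum of the `k_j` and `d n - a` is not a sum of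
the `d - k_j`. -/
def IsGap (k : Fin (m + 2) → ℕ) (n a : ℤ) : Prop :=
  (∀ u : Fin (m + 2) → ℕ, a ≠ ∑ j, (u j : ℤ) * k j) ∧
  (∀ u : Fin (m + 2) → ℕ, (deg k : ℤ) * n - a ≠ ∑ j, (u j : ℤ) * ((deg k : ℤ) - k j))

/-- A representation of the shifted exponent by `u` would give one of the original exponent by `u +
v`. -/
theorem IsGap.sub_sum {k : Fin (m + 2) → ℕ} {n a : ℤ} (h : IsGap k n a) (v : Fin (m + 2) → ℕ) :
    IsGap k (n - ∑ j, (v j : ℤ)) (a - ∑ j, (v j : ℤ) * k j) := by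
  constructor
  · intro u hu
    refine h.1 (u + v) ?_
    simp only [Pi.add_apply, Nat.cast_add, add_mul, Finset.sum_add_distrib]
    linarith
  · intro u hu
    refine h.2 (u + v) ?_
    simp only [Pi.add_apply, Nat.cast_add, add_mul, Finset.sum_add_distrib]
    rw [← hu]
    simp only [mul_sub, Finset.sum_sub_distrib, ← Finset.sum_mul]
    ring

theorem IsGap.sub_single {k : Fin (m + 2) → ℕ} {n a : ℤ} (h : IsGap k n a) (i : Fin (m + 2)) :
    IsGap k (n - 1) (a - k i) := by
  have := h.sub_sum (Pi.single i 1)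
  simpa [Pi.single_apply, apply_ite (Nat.cast : ℕ → ℤ)] using this

theorem IsGap.ne_zero {k : Fin (m + 2) → ℕ} {n a : ℤ} (h : IsGap k n a) : a ≠ 0 := by
  have := h.1 0
  simpa using this

/-- The logarithmic roots of the polynomial `f`, with the values of the complete
sums `∑ ρ^s / f'(ρ)` for `0 ≤ s < d`. -/
structure RootSystem (c : Coordinates m R) (k : Fin (m + 2) → ℕ) (ι : Type*) [Fintype ι] where
  root : ι → LogRoot c k
  injective : ∀ i j, i ≠ j → ((root i).root : R) ≠ (root j).root
  x_zero_ne : c.x 0 ≠ 0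
  x_last_ne : c.x (Fin.last (m + 1)) ≠ 0
  sum_pow : ∀ s : ℕ, s + 1 < deg k → ∑ j, ((root j).root : R) ^ s * ((root j).der⁻¹ : Rˣ) = 0
  sum_pow_top : c.x (Fin.last (m + 1)) *
    ∑ j, ((root j).root : R) ^ (deg k - 1) * ((root j).der⁻¹ : Rˣ) = 1

namespace RootSystem

variable {c : Coordinates m R} {k : Fin (m + 2) → ℕ} {ι : Type*} [Fintype ι]
  (ρ : RootSystem c k ι)

/-- The sum `∑ ρ^s / f'(ρ)` over the roots. -/
def residueSum (s : ℤ) : R :=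
  ∑ j, (((ρ.root j).root ^ s * (ρ.root j).der⁻¹ : Rˣ) : R)

theorem residueSum_rec (s : ℤ) : ∑ i, c.x i * ρ.residueSum (s + k i) = 0 := by
  simp only [residueSum, Finset.mul_sum]
  rw [Finset.sum_comm]
  refine Finset.sum_eq_zero fun j _ => ?_
  have h : ∀ i, c.x i * (((ρ.root j).root ^ (s + k i) * (ρ.root j).der⁻¹ : Rˣ) : R) =
      c.x i * ((ρ.root j).root : R) ^ k i *
        (((ρ.root j).root ^ s * (ρ.root j).der⁻¹ : Rˣ) : R) := by
    intro i
    rw [zpow_add, zpow_natCast]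
    push_cast
    ring
  simp only [h, ← Finset.sum_mul, (ρ.root j).isRoot, zero_mul]

theorem residueSum_natCast (s : ℕ) :
    ρ.residueSum s = ∑ j, ((ρ.root j).root : R) ^ s * ((ρ.root j).der⁻¹ : Rˣ) := by
  simp [residueSum]

theorem residueSum_eq_zero {s : ℤ} (h0 : 0 ≤ s) (h1 : s + 1 < deg k) : ρ.residueSum s = 0 := by
  lift s to ℕ using h0
  rw [residueSum_natCast, ρ.sum_pow s (by omega)]

variable [IsDomain R]

/-- The recurrence, solved for its `x_0` term, expresses the sum at `s` through those at `s + k_i`.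
Descending from the non-zero value at `-1`, only indices with `-s - 1` in the semigroup of the `k_i`
can be reached. -/
theorem residueSum_neg_eq_zero (hk0 : k 0 = 0) (hk : StrictMono k) {s : ℤ} (hs : s < 0)
    (h : ∀ u : Fin (m + 2) → ℕ, -s - 1 ≠ ∑ j, (u j : ℤ) * k j) : ρ.residueSum s = 0 := by
  induction hn : (-s).toNat using Nat.strong_induction_on generalizing s with
  | _ n ih =>
    have h1 := ρ.residueSum_rec s
    rw [Fin.sum_univ_succ, hk0, Finset.sum_eq_zero (s := Finset.univ)] at h1
    · simpa [ρ.x_zero_ne] using h1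
    · intro i _
      have hpos : 0 < k i.succ := hk0 ▸ hk i.succ_pos
      have hle : k i.succ ≤ deg k := hk.monotone (Fin.le_last _)
      -- With `s ≤ -2`, a non-negative `s + k_i` is at most `d - 2`, where the complete sums vanish.
      have hs2 : s ≠ -1 := by
        rintro rfl
        exact h 0 (by simp)
      rcases lt_or_ge (s + k i.succ) 0 with h2 | h2
      · rw [ih _ (by omega) h2 ?_ rfl, mul_zero]
        intro u hu
        refine h (u + Pi.single i.succ 1) ?_
        simp only [Pi.add_apply, Nat.cast_add, add_mul, Finset.sum_add_distrib, ← hu]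
        simp [Pi.single_apply]
        ring
      · rw [ρ.residueSum_eq_zero h2 (by omega), mul_zero]

/-- Solved for its `x_d` term, the recurrence builds the sum at `s` from `1 / x_d` at `d - 1` by
steps `d - k_i`. Each step with `i = 0` costs `d` and contributes one factor `x_0`. The hypothesis
says that no such path contains `N` of these steps, so `N` derivatives in `x_0` kill the sum. -/
theorem D_iterate_residueSum_eq_zero (hk0 : k 0 = 0) (hk : StrictMono k) (s : ℕ) (N : ℕ)
    (h : ∀ u : Fin (m + 2) → ℕ,
      (s : ℤ) - deg k + 1 - deg k * N ≠ ∑ j, (u j : ℤ) * ((deg k : ℤ) - k j)) :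
    (c.D 0)^[N] (ρ.residueSum s) = 0 := by
  have hlast : Fin.last (m + 1) ≠ 0 := (Fin.last_pos).ne'
  have hdpos : 0 < deg k := hk0 ▸ hk (Fin.last_pos)
  induction s using Nat.strong_induction_on generalizing N with
  | _ s ih =>
    rcases lt_trichotomy (s + 1) (deg k) with h1 | h1 | h1
    · rw [ρ.residueSum_eq_zero (by omega) (by omega), c.D_iterate_zero]
    · rcases N with _ | N
      · exact absurd (by simp; omega) (h 0)
      · have h2 := ρ.sum_pow_top
        rw [← h1, Nat.add_sub_cancel, ← ρ.residueSum_natCast] at h2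
        have h3 := congrArg (c.D 0) h2
        rw [Derivation.leibniz, c.D_x, if_neg hlast.symm] at h3
        have h4 : c.D 0 (ρ.residueSum s) = 0 := by simpa [ρ.x_last_ne] using h3
        rw [Function.iterate_succ_apply, h4, c.D_iterate_zero]
    · have hz : ∀ (i : Fin (m + 1)) , (c.D 0)^[N] (ρ.residueSum ((s : ℤ) - deg k + k i.castSucc))
          = 0 := by
        intro i
        have hlt : k i.castSucc < deg k := hk (Fin.castSucc_lt_last i)
        have e : (s : ℤ) - deg k + k i.castSucc = ((s - deg k + k i.castSucc : ℕ) : ℤ) := by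
          omega
        rw [e]
        refine ih _ (by omega) N fun u hu => h (u + Pi.single i.castSucc 1) ?_
        simp only [Pi.add_apply, Nat.cast_add, add_mul, Finset.sum_add_distrib, ← hu]
        simp [Pi.single_apply]
        omega
      have h2 := congrArg (c.D 0)^[N] (ρ.residueSum_rec ((s : ℤ) - deg k))
      rw [c.D_iterate_zero, c.D_iterate_sum, Fin.sum_univ_castSucc,
        Finset.sum_eq_zero (s := Finset.univ), zero_add] at h2
      · rw [c.D_iterate_const_mul _ _ (by rw [c.D_x, if_neg hlast.symm])] at h2
        have e : (s : ℤ) - deg k + k (Fin.last (m + 1)) = s := by rw [deg]; ring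
        rw [e] at h2
        exact (mul_eq_zero.mp h2).resolve_left ρ.x_last_ne
      · intro i _
        rcases N with _ | N
        · have := hz i
          rw [Function.iterate_zero, id] at this ⊢
          rw [this, mul_zero]
        -- For the factor `x_0` the Leibniz rule leaves `D_0^N` of the sum at `s - d`, already zero,
        -- with one derivative fewer; replacing `(s, N + 1)` by `(s - d, N)` does not change the
        -- number that must avoid the semigroup.
        · rw [c.D_iterate_x_mul, hz, mul_zero, zero_add]
          split_ifs with h3
          · rw [← h3, hk0]
            have e : (s : ℤ) - deg k + ((0 : ℕ) : ℤ) = ((s - deg k : ℕ) : ℤ) := by omega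
            rw [e, ih _ (by omega) N, mul_zero]
            intro u hu
            refine h u ?_
            rw [← hu, Nat.cast_sub (by omega)]
            push_cast
            ring
          · rfl

/-- The sum of the functions `ψ_ρ(n, a)` over all roots. -/
def psiSum (n a : ℤ) : R := ∑ j, (ρ.root j).psi n a

omit [IsDomain R] in
theorem psiSum_neg_one (hk0 : k 0 = 0) (a : ℤ) : ρ.psiSum (-1) a = -ρ.residueSum (-a - 1) := by
  rw [psiSum, residueSum, ← Finset.sum_neg_distrib]
  exact Finset.sum_congr rfl fun j _ => (ρ.root j).psi_neg_one a hk0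

omit [IsDomain R] in
theorem D_psiSum (hk0 : k 0 = 0) (i : Fin (m + 2)) (n a : ℤ) :
    c.D i (ρ.psiSum n a) = ρ.psiSum (n - 1) (a - k i) := by
  rw [psiSum, map_sum, psiSum]
  exact Finset.sum_congr rfl fun j _ => (ρ.root j).D_psi hk0 i n a

omit [IsDomain R] in
theorem D_iterate_psiSum (hk0 : k 0 = 0) (N : ℕ) (n a : ℤ) :
    (c.D 0)^[N] (ρ.psiSum n a) = ρ.psiSum (n - N) a := by
  induction N with
  | zero => simp
  | succ N ih =>
    rw [Function.iterate_succ_apply', ih, D_psiSum _ hk0, hk0]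
    congr 1
    · push_cast; ring
    · simp

/-- In degree `-1` the sum is a residue sum of index `-a - 1`, and lower degrees are its derivatives
in `x_0`. The first gap condition settles negative indices and the second one the others. -/
theorem psiSum_eq_zero_of_neg (hk0 : k 0 = 0) (hk : StrictMono k) {n a : ℤ} (hn : n < 0)
    (h : IsGap k n a) : ρ.psiSum n a = 0 := by
  obtain ⟨N, rfl⟩ : ∃ N : ℕ, n = -1 - N := ⟨(-1 - n).toNat, by omega⟩
  rw [← ρ.D_iterate_psiSum hk0, ρ.psiSum_neg_one hk0, c.D_iterate_neg, neg_eq_zero]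
  rcases lt_or_ge (-a - 1) 0 with h1 | h1
  · rw [ρ.residueSum_neg_eq_zero hk0 hk h1, c.D_iterate_zero]
    intro u hu
    exact h.1 u (by linarith)
  · obtain ⟨s, hs⟩ : ∃ s : ℕ, -a - 1 = s := ⟨(-a - 1).toNat, by omega⟩
    rw [hs]
    refine ρ.D_iterate_residueSum_eq_zero hk0 hk s N fun u hu => h.2 u ?_
    rw [← hu, ← hs]
    ring

/-- The sum of `ψ_ρ(n, a) D_i(log ρ)` over all roots. -/
def psiSumDLog (i : Fin (m + 2)) (n a : ℤ) : R := ∑ j, (ρ.root j).psi n a * c.D i (ρ.root j).log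

omit [IsDomain R] in
theorem sum_primWeight_mul_D_log (hk0 : k 0 = 0) (i : Fin (m + 2)) (a : ℤ) (l : ℕ)
    (hl : (l : ℤ) ≠ a) :
    ∑ j, (ρ.root j).primWeight a l * c.D i (ρ.root j).log =
      algebraMap ℂ R (((l : ℤ) - a : ℤ) : ℂ)⁻¹ * ρ.psiSum (-1) (a - l - k i) := by
  rw [psiSum, Finset.mul_sum]
  refine Finset.sum_congr rfl fun j _ => ?_
  rw [LogRoot.primWeight, if_neg hl, (ρ.root j).D_log_eq, (ρ.root j).psi_neg_one _ hk0,
    show -(a - l - k i) - 1 = ((l : ℤ) - a) + ((k i : ℤ) - 1) by ring, zpow_add _ ((l : ℤ) - a)]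
  push_cast
  ring

/-- On a gap no logarithm occurs in `ψ`, so the sum is a combination of residue sums. A coefficient
of `f^n` at `t^l` that is not zero comes from a vector of size `n`, and subtracting it and then a
column turns the gap into a gap of degree `-1`. -/
theorem psiSumDLog_eq_zero (hk0 : k 0 = 0) (hk : StrictMono k) (i : Fin (m + 2)) {n a : ℤ}
    (hn : 0 ≤ n) (h : IsGap k n a) : ρ.psiSumDLog i n a = 0 := by
  lift n to ℕ using hn
  simp only [psiSumDLog, LogRoot.psi_natCast, LogRoot.psiNat, LogRoot.prim,
    weighted_eq_sum _ _ (Nat.lt_succ_self _), Finset.sum_mul]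
  rw [Finset.sum_comm]
  refine Finset.sum_eq_zero fun l _ => ?_
  simp only [mul_assoc]
  rw [← Finset.mul_sum]
  by_cases hc : (c.divPow k n).coeff l = 0
  · rw [hc, zero_mul]
  · obtain ⟨u, hu, hul⟩ := c.exists_of_coeff_divPow_ne_zero k hc
    have hul' : (l : ℤ) = ∑ j, (u j : ℤ) * k j := by rw [← hul]; push_cast; rfl
    have hg := (h.sub_sum u).sub_single i
    rw [← hul', ← Nat.cast_sum, hu, sub_self, zero_sub] at hg
    rw [ρ.sum_primWeight_mul_D_log hk0 i a l fun h1 => h.1 u (h1 ▸ hul'),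
      ρ.psiSum_eq_zero_of_neg hk0 hk (by norm_num) hg, mul_zero, mul_zero]

omit [IsDomain R] in
theorem _root_.MonomialCurve.LogRoot.sum_k_mul_x_mul_D_log (ρ : LogRoot c k) :
    ∑ i, (k i : R) * c.x i * c.D i ρ.log = -1 := by
  have h : ∀ i, (k i : R) * c.x i * c.D i ρ.log =
      ((k i : R) * c.x i * (ρ.root : R) ^ k i) * -((ρ.root⁻¹ * ρ.der⁻¹ : Rˣ) : R) := by
    intro i
    rw [ρ.D_log_eq, zpow_sub_one, zpow_natCast]
    push_cast
    ring
  simp only [h, ← Finset.sum_mul, ρ.der_eq]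
  rw [mul_neg, ← Units.val_mul, ← Units.val_mul, mul_mul_mul_comm, mul_inv_cancel,
    mul_inv_cancel, one_mul, Units.val_one]

omit [IsDomain R] in
theorem _root_.MonomialCurve.LogRoot.sum_x_mul_D_log (ρ : LogRoot c k) :
    ∑ i, c.x i * c.D i ρ.log = 0 := by
  have h : ∀ i, c.x i * c.D i ρ.log =
      (c.x i * (ρ.root : R) ^ k i) * -((ρ.root⁻¹ * ρ.der⁻¹ : Rˣ) : R) := by
    intro i
    rw [ρ.D_log_eq, zpow_sub_one, zpow_natCast]
    push_cast
    ring
  simp only [h, ← Finset.sum_mul, ρ.isRoot, zero_mul]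

omit [IsDomain R] in
theorem sum_k_mul_x_mul_psiSumDLog (n a : ℤ) :
    ∑ i, (k i : R) * c.x i * ρ.psiSumDLog i n a = -ρ.psiSum n a := by
  simp only [psiSumDLog, Finset.mul_sum]
  rw [Finset.sum_comm, psiSum, ← Finset.sum_neg_distrib]
  refine Finset.sum_congr rfl fun j _ => ?_
  rw [← mul_neg_one, ← (ρ.root j).sum_k_mul_x_mul_D_log, Finset.mul_sum]
  exact Finset.sum_congr rfl fun i _ => by ring

omit [IsDomain R] in
theorem sum_x_mul_psiSumDLog (n a : ℤ) :
    ∑ i, c.x i * ρ.psiSumDLog i n a = 0 := by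
  simp only [psiSumDLog, Finset.mul_sum]
  rw [Finset.sum_comm]
  refine Finset.sum_eq_zero fun j _ => ?_
  rw [← mul_zero, ← (ρ.root j).sum_x_mul_D_log, Finset.mul_sum]
  exact Finset.sum_congr rfl fun i _ => by ring

/-- In non-negative degree the identity `∑ k_i x_i D_i(log ρ) = -1` writes the sum through the
vanishing sums `psiSumDLog`. -/
theorem psiSum_eq_zero (hk0 : k 0 = 0) (hk : StrictMono k) {n a : ℤ} (h : IsGap k n a) :
    ρ.psiSum n a = 0 := by
  rcases lt_or_ge n 0 with hn | hn
  · exact ρ.psiSum_eq_zero_of_neg hk0 hk hn h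
  · rw [← neg_eq_zero, ← sum_k_mul_x_mul_psiSumDLog]
    exact Finset.sum_eq_zero fun i _ => by rw [ρ.psiSumDLog_eq_zero hk0 hk i hn h, mul_zero]

/-- The sum of `ψ_ρ(n, a) log ρ` over all roots. -/
def psiLogSum (n a : ℤ) : R := ∑ j, (ρ.root j).psi n a * (ρ.root j).log

omit [IsDomain R] in
theorem D_psiLogSum (hk0 : k 0 = 0) (i : Fin (m + 2)) (n a : ℤ) :
    c.D i (ρ.psiLogSum n a) = ρ.psiLogSum (n - 1) (a - k i) + ρ.psiSumDLog i n a := by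
  rw [psiLogSum, map_sum, psiLogSum, psiSumDLog, ← Finset.sum_add_distrib]
  refine Finset.sum_congr rfl fun j _ => ?_
  rw [Derivation.leibniz, (ρ.root j).D_psi hk0]
  simp only [smul_eq_mul]
  ring

omit [IsDomain R] in
theorem sum_x_mul_D_psiLogSum (hk0 : k 0 = 0) (n a : ℤ) :
    ∑ i, c.x i * c.D i (ρ.psiLogSum n a) = n * ρ.psiLogSum n a := by
  simp only [ρ.D_psiLogSum hk0, mul_add, Finset.sum_add_distrib, sum_x_mul_psiSumDLog, add_zero]
  simp only [psiLogSum, Finset.mul_sum]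
  rw [Finset.sum_comm]
  refine Finset.sum_congr rfl fun j _ => ?_
  rw [← mul_assoc, ← (ρ.root j).sum_x_mul_psi hk0, Finset.sum_mul]
  exact Finset.sum_congr rfl fun i _ => by ring

omit [IsDomain R] in
theorem sum_k_mul_x_mul_D_psiLogSum (hk0 : k 0 = 0) (n a : ℤ) :
    ∑ i, (k i : R) * c.x i * c.D i (ρ.psiLogSum n a) =
      a * ρ.psiLogSum n a - c.phi k n a * ∑ j, (ρ.root j).log - ρ.psiSum n a := by
  simp only [ρ.D_psiLogSum hk0, mul_add, Finset.sum_add_distrib, sum_k_mul_x_mul_psiSumDLog,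
    ← sub_eq_add_neg]
  congr 1
  simp only [psiLogSum, Finset.mul_sum]
  rw [Finset.sum_comm, ← Finset.sum_sub_distrib]
  refine Finset.sum_congr rfl fun j _ => ?_
  rw [← mul_assoc, ← sub_mul, ← (ρ.root j).sum_k_mul_x_mul_psi hk0, Finset.sum_mul]
  exact Finset.sum_congr rfl fun i _ => by ring

omit [IsDomain R] [Fintype ι] in
theorem _root_.MonomialCurve.Coordinates.phi_eq_zero (c : Coordinates m R) {n a : ℤ}
    (h : IsGap k n a) : c.phi k n a = 0 := by
  rw [Coordinates.phi]
  split_ifs with h1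
  · by_contra h2
    obtain ⟨u, -, hu⟩ := c.exists_of_coeff_divPow_ne_zero k h2
    refine h.1 u ?_
    rw [← Int.toNat_of_nonneg h1.2, ← hu]
    push_cast
    rfl
  · rfl

/-- The function `χ(n, a)`, for `a ≠ 0`. -/
def chi (n a : ℤ) : R :=
  if 0 ≤ n then ρ.psiLogSum n a else (c.D 0)^[(-n).toNat] (ρ.psiLogSum 0 a)

omit [IsDomain R] in
theorem chi_natCast (n : ℕ) (a : ℤ) : ρ.chi n a = ρ.psiLogSum n a := by simp [chi]

omit [IsDomain R] in
theorem chi_neg (n : ℕ) (a : ℤ) : ρ.chi (-n) a = (c.D 0)^[n] (ρ.psiLogSum 0 a) := by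
  rcases n with _ | n
  · simp [chi]
  · rw [chi, if_neg (by push_cast; omega)]; simp

/-- The error term `psiSumDLog` in degree zero need not vanish, because `(0, a)` need not be a gap.
It is a scalar multiple of `psiSum` in degree `-1`, and `N` further derivatives move that to the gap
in the hypothesis. -/
theorem D_iterate_D_psiLogSum (hk0 : k 0 = 0) (hk : StrictMono k) (N : ℕ) (i : Fin (m + 2)) {a : ℤ}
    (ha : a ≠ 0) (h : IsGap k (-N - 1) (a - k i)) :
    (c.D 0)^[N] (c.D i (ρ.psiLogSum 0 a)) = (c.D 0)^[N] (ρ.psiLogSum (-1) (a - k i)) := by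
  have h1 : ρ.psiSumDLog i 0 a =
      algebraMap ℂ R (((0 : ℕ) : ℤ) - a : ℤ)⁻¹ * ρ.psiSum (-1) (a - k i) := by
    have h2 := ρ.sum_primWeight_mul_D_log hk0 i a 0 (by simpa using ha.symm)
    rw [Nat.cast_zero, sub_zero] at h2
    rw [Nat.cast_zero, ← h2, psiSumDLog]
    refine Finset.sum_congr rfl fun j _ => ?_
    rw [← LogRoot.psiNat_zero, ← LogRoot.psi_natCast, Nat.cast_zero]
  rw [ρ.D_psiLogSum hk0, h1, c.D_iterate_add,
    c.D_iterate_const_mul _ _ (Derivation.map_algebraMap _ _), ρ.D_iterate_psiSum hk0,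
    show (-1 - N : ℤ) = -N - 1 by ring, ρ.psiSum_eq_zero hk0 hk h, mul_zero, add_zero, zero_sub]

theorem chi_neg_succ (hk0 : k 0 = 0) (hk : StrictMono k) (N : ℕ) {a : ℤ}
    (h : IsGap k (-N - 1) a) : ρ.chi (-N - 1) a = (c.D 0)^[N] (ρ.psiLogSum (-1) a) := by
  have h1 := ρ.D_iterate_D_psiLogSum hk0 hk N 0 h.ne_zero (by simpa [hk0] using h)
  have e : (-N - 1 : ℤ) = -((N + 1 : ℕ) : ℤ) := by push_cast; ring
  rw [e, chi_neg, Function.iterate_succ_apply, h1, hk0]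
  simp

/-- The gap condition removes the error terms in non-negative degree directly, and in negative
degree after the iterated `D 0`. -/
theorem D_chi (hk0 : k 0 = 0) (hk : StrictMono k) (i : Fin (m + 2)) {n a : ℤ} (h : IsGap k n a) :
    c.D i (ρ.chi n a) = ρ.chi (n - 1) (a - k i) := by
  obtain ⟨n, rfl | rfl⟩ := n.eq_nat_or_neg
  · rcases n with _ | n
    · have h1 := ρ.chi_neg_succ hk0 hk 0 (by simpa using h.sub_single i)
      rw [chi_natCast, D_psiLogSum _ hk0, ρ.psiSumDLog_eq_zero hk0 hk i (by simp) h]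
      simpa using h1.symm
    · rw [chi_natCast, D_psiLogSum _ hk0, ρ.psiSumDLog_eq_zero hk0 hk i (by positivity) h,
        add_zero]
      simp [chi]
  · rw [chi_neg, c.D_iterate_comm, ρ.D_iterate_D_psiLogSum hk0 hk n i h.ne_zero (h.sub_single i),
      ρ.chi_neg_succ hk0 hk n (h.sub_single i)]

theorem sum_x_mul_D_chi (hk0 : k 0 = 0) (hk : StrictMono k) {n a : ℤ} (h : IsGap k n a) :
    ∑ i, c.x i * c.D i (ρ.chi n a) = n * ρ.chi n a := by
  rcases lt_or_ge n 0 with hn | hn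
  · obtain ⟨N, rfl⟩ : ∃ N : ℕ, n = -N - 1 := ⟨(-1 - n).toNat, by omega⟩
    rw [ρ.chi_neg_succ hk0 hk N h]
    -- The Euler relation in degree `-1` is differentiated; commuting `D 0` past the factor `x 0`
    -- lowers the eigenvalue from `-1` to `-N - 1`.
    have h1 := congrArg (c.D 0)^[N] (ρ.sum_x_mul_D_psiLogSum hk0 (-1) a)
    rw [c.D_iterate_sum, c.D_iterate_const_mul _ _ (Derivation.map_intCast _ _)] at h1
    rcases N with _ | N
    · simpa using h1
    · simp only [c.D_iterate_x_mul, Finset.sum_add_distrib, Finset.sum_ite_eq, Finset.mem_univ,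
        if_true, ← c.D_iterate_comm, ← Function.iterate_succ_apply'] at h1
      push_cast at h1 ⊢
      simp only [Function.iterate_succ_apply'] at h1 ⊢
      linear_combination h1
  · lift n to ℕ using hn
    rw [chi_natCast, sum_x_mul_D_psiLogSum _ hk0]

/-- For `psiLogSum` the defects are `phi` times the sum of the logarithms and `psiSum`. Both
disappear on a gap, in negative degree after the iterated `D 0`, which commutes with this operator
since `k 0 = 0`. -/
theorem sum_k_mul_x_mul_D_chi (hk0 : k 0 = 0) (hk : StrictMono k) {n a : ℤ} (h : IsGap k n a) :
    ∑ i, (k i : R) * c.x i * c.D i (ρ.chi n a) = a * ρ.chi n a := by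
  rcases lt_or_ge n 0 with hn | hn
  · obtain ⟨N, rfl⟩ : ∃ N : ℕ, n = -N - 1 := ⟨(-1 - n).toNat, by omega⟩
    rw [ρ.chi_neg_succ hk0 hk N h]
    have h1 := congrArg (c.D 0)^[N] (ρ.sum_k_mul_x_mul_D_psiLogSum hk0 (-1) a)
    rw [Coordinates.phi, if_neg (by simp), zero_mul, sub_zero, sub_eq_add_neg, c.D_iterate_add,
      c.D_iterate_neg, ρ.D_iterate_psiSum hk0, show (-1 - N : ℤ) = -N - 1 by ring,
      ρ.psiSum_eq_zero hk0 hk h, neg_zero, add_zero,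
      c.D_iterate_const_mul _ _ (Derivation.map_intCast _ _), c.D_iterate_sum] at h1
    rw [← h1]
    refine Finset.sum_congr rfl fun i _ => ?_
    rw [c.D_iterate_const_mul, c.D_iterate_comm]
    rw [Derivation.leibniz, c.D_x, Derivation.map_natCast]
    split_ifs with hi
    · simp [← hi, hk0]
    · simp
  · lift n to ℕ using hn
    rw [chi_natCast, sum_k_mul_x_mul_D_psiLogSum _ hk0, ρ.psiSum_eq_zero hk0 hk h,
      c.phi_eq_zero h]
    ring

end RootSystem

end RootSums

/-! ### Long intervals of exponents, and separation of the roots by residues. -/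

section Residues

open Polynomial

variable {m : ℕ}

theorem exists_sum_mul_eq (k : Fin (m + 2) → ℕ) (hgcd : Finset.univ.gcd k = 1) :
    ∃ c₀ : ℕ, ∀ v ≥ c₀, ∃ u : Fin (m + 2) → ℕ, ∑ j, u j * k j = v := by
  obtain ⟨c₀, h⟩ := Nat.exists_mem_closure_of_ge (Set.range k)
  have hg : Nat.setGcd (Set.range k) = 1 := by
    rw [← Nat.dvd_one, ← hgcd]
    exact Finset.dvd_gcd fun i _ => Nat.setGcd_dvd_of_mem ⟨i, rfl⟩
  refine ⟨c₀, fun v hv => ?_⟩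
  have h1 := h v hv (hg ▸ one_dvd v)
  rw [← Submodule.span_nat_eq_addSubmonoidClosure] at h1
  obtain ⟨u, hu⟩ := (Submodule.mem_span_range_iff_exists_fun ℕ).mp h1
  exact ⟨u, by simpa using hu⟩

/-- With exactly `N` summands one reaches an interval whose length grows like `(d - 1) N`; this
slope matches the degree of `separating`. -/
theorem exists_sum_eq_and_sum_mul_eq (k : Fin (m + 2) → ℕ) (hk0 : k 0 = 0) (hk : StrictMono k)
    (hgcd : Finset.univ.gcd k = 1) :
    ∃ c₀ : ℕ, ∀ C : ℕ, ∃ N₀ : ℕ, ∀ N ≥ N₀, ∀ w : ℕ, w ≤ (deg k - 1) * N + C →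
      ∃ u : Fin (m + 2) → ℕ, ∑ j, u j = N ∧ ∑ j, u j * k j = c₀ + w := by
  have hd : 0 < deg k := hk0 ▸ hk (Fin.last_pos)
  obtain ⟨c₀, h⟩ := exists_sum_mul_eq k hgcd
  -- Represent `c₀ + w % d` with a bounded number of positive summands, add `w / d` summands `d`,
  -- and pad with the exponent `k 0 = 0` up to `N` summands; this bound on `N` leaves room for the
  -- padding.
  refine ⟨c₀, fun C => ⟨deg k * (c₀ + deg k) + C, fun N hN w hw => ?_⟩⟩
  obtain ⟨u, hu⟩ := h (c₀ + w % deg k) (by omega)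
  have hmod := Nat.mod_lt w hd
  have hdiv := Nat.div_add_mod w (deg k)
  set q := w / deg k
  rw [Fin.sum_univ_succ, hk0, mul_zero, zero_add] at hu
  have hT : ∑ j : Fin (m + 1), u j.succ ≤ c₀ + deg k := by
    refine le_trans (Finset.sum_le_sum fun j _ => ?_) (hu.le.trans (by omega))
    exact Nat.le_mul_of_pos_right _ (hk0 ▸ hk j.succ_pos)
  have hTN : (∑ j : Fin (m + 1), u j.succ) + q ≤ N := by
    have h1 : deg k * (c₀ + deg k + q) ≤ deg k * N := by
      have h2 : (deg k - 1) * N + N = deg k * N := by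
        rw [← Nat.succ_mul, Nat.succ_eq_add_one, Nat.sub_add_cancel hd]
      rw [mul_add]
      omega
    have := Nat.le_of_mul_le_mul_left h1 hd
    omega
  refine ⟨Fin.cons (N - ((∑ j : Fin (m + 1), u j.succ) + q))
    (fun j => u j.succ + if j = Fin.last m then q else 0), ?_, ?_⟩
  · rw [Fin.sum_univ_succ]
    simp only [Fin.cons_zero, Fin.cons_succ, Finset.sum_add_distrib, Finset.sum_ite_eq',
      Finset.mem_univ, if_true]
    omega
  · rw [Fin.sum_univ_succ]
    simp only [Fin.cons_zero, Fin.cons_succ, add_mul, Finset.sum_add_distrib, ite_mul, zero_mul,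
      Finset.sum_ite_eq', Finset.mem_univ, if_true, hk0, mul_zero, hu, Fin.succ_last]
    have : q * k (Fin.last m.succ) = deg k * q := by rw [deg, mul_comm]
    omega

variable {R : Type*} [CommRing R] [Algebra ℂ R]

namespace LogRoot

variable {c : Coordinates m R} {k : Fin (m + 2) → ℕ} (ρ : LogRoot c k)

/-- The `R`-linear functional on `R[X]` with values `ψ(-M, b - n)` at `X ^ n`; up to a scalar it is
the residue of `t ^ (- b - 1) p(t) / f(t) ^ M` at the root. -/
def res (M : ℕ) (b : ℤ) : R[X] →ₗ[R] R := weighted fun n => ρ.psi (-M) (b - n)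

/-- As `∂f/∂x_0 = 1`, differentiation in `x_0` raises the power of `f` in the denominator; the
correction removes the dependence of `p` on `x_0`. -/
theorem res_succ (hk : k 0 = 0) (M : ℕ) (b : ℤ) (p : R[X]) :
    ρ.res (M + 1) b p = c.D 0 (ρ.res M b p) - ρ.res M b (coeffDerivation (c.D 0) p) := by
  have h : (fun n : ℕ => c.D 0 (ρ.psi (-M) (b - n))) =
      fun n : ℕ => ρ.psi (-(M + 1 : ℕ)) (b - n) := by
    ext n
    rw [ρ.D_psi hk, hk]
    congr 1
    · push_cast; ring
    · simp
  rw [res, res, derivation_weighted, h]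
  ring

theorem res_one (hk : k 0 = 0) (b : ℤ) (p : R[X]) :
    ρ.res 1 b p = p.eval (ρ.root : R) * -((ρ.root ^ (-b - 1) * ρ.der⁻¹ : Rˣ) : R) := by
  rw [← weighted_mul_pow, res]
  congr 2
  ext n
  rw [Nat.cast_one, psi_neg_one _ _ hk, show -(b - n) - 1 = n + (-b - 1) by ring, zpow_add,
    zpow_natCast]
  push_cast
  ring

theorem coeffDerivation_pow_mul (D : Derivation ℂ R R) (r : R) (M : ℕ) (p : R[X]) :
    coeffDerivation D ((X - C r) ^ (M + 1) * p) =
      (X - C r) ^ M * ((X - C r) * coeffDerivation D p) -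
        ((M : R) + 1) • ((X - C r) ^ M * (C (D r) * p)) := by
  rw [Derivation.leibniz, Derivation.leibniz_pow, map_sub, coeffDerivation_X, coeffDerivation_C,
    smul_eq_C_mul]
  simp only [Nat.add_sub_cancel, smul_eq_mul, nsmul_eq_mul]
  simp
  ring

/-- The zero of order `M + 1` cancels the pole of `1 / f^(M+1)`. -/
theorem res_eq_zero (hk : k 0 = 0) (M : ℕ) (b : ℤ) (p : R[X]) :
    ρ.res (M + 1) b ((X - C (ρ.root : R)) ^ (M + 1) * p) = 0 := by
  induction M generalizing p with
  | zero => rw [zero_add, res_one _ hk]; simp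
  | succ M ih =>
    have h1 : (X - C (ρ.root : R)) ^ (M + 1 + 1) * p =
        (X - C (ρ.root : R)) ^ (M + 1) * ((X - C (ρ.root : R)) * p) := by ring
    rw [res_succ _ hk, coeffDerivation_pow_mul, h1, map_sub, ih, ih, map_smul, ih]
    simp

/-- Only a simple pole remains, so the residue is explicit; it supplies the non-vanishing in
`res_separating_ne_zero`. -/
theorem res_pow_mul (hk : k 0 = 0) (M : ℕ) (b : ℤ) (p : R[X]) :
    ρ.res (M + 1) b ((X - C (ρ.root : R)) ^ M * p) =
      (M.factorial : R) * c.D 0 ρ.root ^ M * p.eval (ρ.root : R) *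
        -((ρ.root ^ (-b - 1) * ρ.der⁻¹ : Rˣ) : R) := by
  induction M generalizing p with
  | zero => rw [zero_add, res_one _ hk]; simp
  | succ M ih =>
    have h1 : (X - C (ρ.root : R)) ^ M * ((X - C (ρ.root : R)) * coeffDerivation (c.D 0) p) =
        (X - C (ρ.root : R)) ^ (M + 1) * coeffDerivation (c.D 0) p := by ring
    rw [res_succ _ hk, coeffDerivation_pow_mul, h1, map_sub, res_eq_zero _ hk, res_eq_zero _ hk,
      map_smul, ih, Nat.factorial_succ]
    simp
    ring

end LogRoot

namespace RootSystem

variable {c : Coordinates m R} {k : Fin (m + 2) → ℕ} {ι : Type*} [Fintype ι] [DecidableEq ι]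
  (ρ : RootSystem c k ι)

/-- The polynomial vanishing to order `M + 1` at all roots but `i` and `j`, and to order `M`
at `j`. -/
def separating (i j : ι) (M : ℕ) : R[X] :=
  (X - C ((ρ.root j).root : R)) ^ M *
    ∏ l ∈ (Finset.univ.erase i).erase j, (X - C ((ρ.root l).root : R)) ^ (M + 1)

theorem natDegree_separating_le {i j : ι} (hij : j ≠ i) (M : ℕ) :
    (ρ.separating i j M).natDegree ≤ (Fintype.card ι - 1) * (M + 1) := by
  have h1 : ((Finset.univ.erase i).erase j).card + 1 = Fintype.card ι - 1 := by
    rw [Finset.card_erase_add_one (Finset.mem_erase.mpr ⟨hij, Finset.mem_univ _⟩),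
      Finset.card_erase_of_mem (Finset.mem_univ _), Finset.card_univ]
  have h2 : ∀ (a : R) n, ((X - C a) ^ n).natDegree ≤ n := fun a n =>
    natDegree_pow_le.trans ((Nat.mul_le_mul_left n (natDegree_X_sub_C_le a)).trans (by simp))
  refine natDegree_mul_le.trans ?_
  have h3 := (natDegree_prod_le ((Finset.univ.erase i).erase j)
    (fun l => (X - C ((ρ.root l).root : R)) ^ (M + 1))).trans
    (Finset.sum_le_sum fun l _ => h2 _ _)
  rw [Finset.sum_const, smul_eq_mul] at h3
  have h4 := h2 ((ρ.root j).root : R) M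
  rw [← h1, add_mul, one_mul]
  omega

theorem res_separating_eq_zero (hk : k 0 = 0) {i j l : ι} (hi : l ≠ i) (hj : l ≠ j) (M : ℕ)
    (b : ℤ) : (ρ.root l).res (M + 1) b (ρ.separating i j M) = 0 := by
  have hl : l ∈ (Finset.univ.erase i).erase j := by simp [hi, hj]
  rw [separating, ← Finset.mul_prod_erase _ _ hl, mul_left_comm, LogRoot.res_eq_zero _ hk]

variable [IsDomain R]

theorem res_separating_ne_zero (hk : k 0 = 0) (i j : ι) (M : ℕ) (b : ℤ) :
    (ρ.root j).res (M + 1) b (ρ.separating i j M) ≠ 0 := by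
  have : CharZero R := charZero_of_injective_algebraMap (algebraMap ℂ R).injective
  rw [separating, LogRoot.res_pow_mul _ hk]
  refine mul_ne_zero (mul_ne_zero (mul_ne_zero ?_ (pow_ne_zero _ ?_)) ?_)
    (neg_ne_zero.mpr (Units.ne_zero _))
  · exact_mod_cast M.factorial_ne_zero
  · rw [LogRoot.D_root]
    exact mul_ne_zero (neg_ne_zero.mpr (pow_ne_zero _ (Units.ne_zero _))) (Units.ne_zero _)
  · rw [eval_prod]
    refine Finset.prod_ne_zero_iff.mpr fun l hl => ?_
    rw [eval_pow, eval_sub, eval_X, eval_C]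
    exact pow_ne_zero _ (sub_ne_zero.mpr (ρ.injective _ _ (Finset.ne_of_mem_erase hl).symm))

omit [Fintype ι] [DecidableEq ι] [IsDomain R] in
theorem _root_.MonomialCurve.LogRoot.res_eq_sum (ρ : LogRoot c k) (M : ℕ) (b : ℤ) (p : R[X]) :
    ρ.res M b p =
      ∑ l ∈ Finset.range (p.natDegree + 1), p.coeff l * ρ.psi (-M) (b - l) :=
  weighted_eq_sum _ _ (Nat.lt_succ_self _)

end RootSystem

/-- The exponents `(n, a) - A u` cover, in degree `-M - 1` for large `M`, a long interval. -/
theorem exists_sub_sum_eq (k : Fin (m + 2) → ℕ) (hk0 : k 0 = 0) (hk : StrictMono k)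
    (hgcd : Finset.univ.gcd k = 1) (n a : ℤ) :
    ∃ (M : ℕ) (b : ℤ), ∀ l ≤ (deg k - 1) * (M + 1), ∃ u : Fin (m + 2) → ℕ,
      -((M + 1 : ℕ) : ℤ) = n - ∑ j, (u j : ℤ) ∧ b - l = a - ∑ j, (u j : ℤ) * k j := by
  obtain ⟨c₀, h⟩ := exists_sum_eq_and_sum_mul_eq k hk0 hk hgcd
  obtain ⟨N₀, h⟩ := h ((deg k - 1) * n.natAbs)
  -- With `N = n + M + 1` summands the degree falls to `-M - 1`; `N ≥ N₀`, and `M + 1 ≤ N + |n|`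
  -- explains the slack `(d - 1) |n|`.
  refine ⟨N₀ + n.natAbs, a - c₀, fun l hl => ?_⟩
  obtain ⟨N, hN⟩ : ∃ N : ℕ, (N : ℤ) = n + (N₀ + n.natAbs + 1 : ℕ) :=
    ⟨(n + (N₀ + n.natAbs + 1 : ℕ)).toNat, by omega⟩
  obtain ⟨u, hu1, hu2⟩ := h N (by omega) l (hl.trans (by
    rw [← mul_add]; exact Nat.mul_le_mul_left _ (by omega)))
  have h1 : ∑ j, (u j : ℤ) = N := by rw [← hu1]; push_cast; rfl
  have h2 : ∑ j, (u j : ℤ) * k j = c₀ + l := by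
    have := congrArg (Nat.cast : ℕ → ℤ) hu2
    push_cast at this
    exact this
  refine ⟨u, ?_, ?_⟩
  · rw [h1]; push_cast at hN ⊢; linarith
  · rw [h2]; ring

/-- A predicate on exponents that is stable under `α ↦ α - a_i` is stable under `α ↦ α - A u`. -/
theorem sub_sum_induction {k : Fin (m + 2) → ℕ} {p : ℤ → ℤ → Prop}
    (hp : ∀ n a i, p n a → p (n - 1) (a - k i)) {n a : ℤ} (h : p n a)
    (u : Fin (m + 2) → ℕ) : p (n - ∑ j, (u j : ℤ)) (a - ∑ j, (u j : ℤ) * k j) := by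
  induction hs : ∑ j, u j generalizing u with
  | zero =>
    have : u = 0 := by
      ext j
      simpa using (Finset.sum_eq_zero_iff.mp hs) j (Finset.mem_univ j)
    subst this
    simpa using h
  | succ s ih =>
    obtain ⟨i, hi⟩ : ∃ i, u i ≠ 0 := by
      by_contra! h0
      simp [h0] at hs
    have hu : u = (u - Pi.single i 1) + Pi.single i 1 := by
      ext j
      rcases eq_or_ne j i with rfl | hj
      · simp; omega
      · simp [hj]
    have h1 : ∑ j, (u - Pi.single i 1 : Fin (m + 2) → ℕ) j = s := by
      rw [hu] at hs
      simp only [Pi.add_apply, Finset.sum_add_distrib] at hs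
      simpa [Pi.single_apply] using hs
    have h2 := hp _ _ i (ih _ h1)
    convert! h2 using 1
    · conv_lhs => rw [hu]
      simp only [Pi.add_apply, Nat.cast_add, Finset.sum_add_distrib, Pi.single_apply]
      simp
      ring
    · conv_lhs => rw [hu]
      simp only [Pi.add_apply, Nat.cast_add, add_mul, Finset.sum_add_distrib, Pi.single_apply]
      simp
      ring

namespace RootSystem

variable {c : Coordinates m R} {k : Fin (m + 2) → ℕ} {ι : Type*} [Fintype ι]
  (ρ : RootSystem c k ι) [IsDomain R]

/-- Differentiation spreads the relation over the interval of `exists_sub_sum_eq`, and combining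
with the coefficients of `separating i j M` leaves `s j` times a non-zero residue. The root `i`,
which the polynomial does not kill, is absent because `s i = 0`. -/
theorem coefficient_eq_zero (hk0 : k 0 = 0) (hk : StrictMono k) (hgcd : Finset.univ.gcd k = 1)
    (hcard : Fintype.card ι = deg k) {n a : ℤ} {s : ι → ℂ} {i : ι} (hi : s i = 0)
    (h : ∑ j, algebraMap ℂ R (s j) * (ρ.root j).psi n a = 0) (j : ι) : s j = 0 := by
  classical
  rcases eq_or_ne j i with rfl | hij
  · exact hi
  have hu := sub_sum_induction (k := k)
    (p := fun n a => ∑ j, algebraMap ℂ R (s j) * (ρ.root j).psi n a = 0) (by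
      intro n a i h
      have := congrArg (c.D i) h
      simpa [Derivation.leibniz, LogRoot.D_psi _ hk0] using this) h
  obtain ⟨M, b, hM⟩ := exists_sub_sum_eq k hk0 hk hgcd n a
  have h1 : ∑ l, algebraMap ℂ R (s l) * (ρ.root l).res (M + 1) b (ρ.separating i j M) = 0 := by
    simp only [LogRoot.res_eq_sum, Finset.mul_sum]
    rw [Finset.sum_comm]
    refine Finset.sum_eq_zero fun l hl => ?_
    obtain ⟨u, hu1, hu2⟩ := hM l (by
      have := ρ.natDegree_separating_le hij M
      rw [hcard] at this
      have := Finset.mem_range.mp hl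
      omega)
    rw [hu1, hu2, ← mul_zero ((ρ.separating i j M).coeff l), ← hu u, Finset.mul_sum]
    exact Finset.sum_congr rfl fun l _ => by ring
  rw [Finset.sum_eq_single j] at h1
  · have h2 := (mul_eq_zero.mp h1).resolve_right (ρ.res_separating_ne_zero hk0 i j M b)
    exact (algebraMap ℂ R).injective (h2.trans (map_zero _).symm)
  · intro l _ hl
    rcases eq_or_ne l i with rfl | hli
    · rw [hi, map_zero, zero_mul]
    · rw [ρ.res_separating_eq_zero hk0 hli hl, mul_zero]
  · simp

section Subalgebra

variable (A : Subalgebra ℂ R) (hD : ∀ i, ∀ a ∈ A, c.D i a ∈ A)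
  (hdiv : ∀ a b, a ∈ A → a ≠ 0 → a * b ∈ A → b ∈ A) (hx : ∀ i, c.x i ∈ A)
  (hr : ∀ j, ((ρ.root j).root : R) ∈ A)

include hdiv in
omit [Fintype ι] in
theorem inv_mem {u : Rˣ} (hu : (u : R) ∈ A) : ((u⁻¹ : Rˣ) : R) ∈ A :=
  hdiv u _ hu u.ne_zero (by simp [A.one_mem])

include hdiv in
omit [Fintype ι] in
theorem zpow_mem {u : Rˣ} (hu : (u : R) ∈ A) (n : ℤ) : ((u ^ n : Rˣ) : R) ∈ A := by
  obtain ⟨n, rfl | rfl⟩ := n.eq_nat_or_neg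
  · rw [zpow_natCast, Units.val_pow_eq_pow_val]
    exact A.pow_mem hu n
  · rw [zpow_neg, zpow_natCast]
    exact inv_mem A hdiv (by rw [Units.val_pow_eq_pow_val]; exact A.pow_mem hu n)

include hdiv hx hr in
theorem D_log_mem (i : Fin (m + 2)) (j : ι) : c.D i (ρ.root j).log ∈ A := by
  have h1 : ((ρ.root j).der : R) ∈ A := by
    refine hdiv _ _ (hr j) (Units.ne_zero _) ?_
    rw [← (ρ.root j).der_eq]
    exact A.sum_mem fun i _ => A.mul_mem (A.mul_mem (natCast_mem A _) (hx i))
      (A.pow_mem (hr j) _)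
  rw [LogRoot.D_log_eq, Units.val_mul]
  exact A.neg_mem (A.mul_mem (zpow_mem A hdiv (hr j) _) (inv_mem A hdiv h1))

include hx in
omit [Fintype ι] [IsDomain R] in
theorem coeff_divPow_mem (n l : ℕ) : (c.divPow k n).coeff l ∈ A := by
  rw [c.divPow_eq_sum, finsetSum_coeff]
  refine A.sum_mem fun u _ => ?_
  rw [coeff_monomial]
  split_ifs
  · exact A.prod_mem fun i _ => A.mul_mem (A.pow_mem (hx i) _) (A.algebraMap_mem _)
  · exact A.zero_mem

include hD in
omit [IsDomain R] in
theorem D_iterate_mem (i : Fin (m + 2)) (N : ℕ) {a : R} (ha : a ∈ A) : (c.D i)^[N] a ∈ A := by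
  induction N with
  | zero => exact ha
  | succ N ih => rw [Function.iterate_succ_apply']; exact hD i _ ih

include hdiv hx hr hD in
-- The only logarithm in `ψ` is weighted by the coefficient of `f^n` at `t^a`, which vanishes on a
-- gap.
theorem psi_mem {n a : ℤ} (h : IsGap k n a) (j : ι) : (ρ.root j).psi n a ∈ A := by
  have hw : ∀ l : ℕ, (l : ℤ) ≠ a → (ρ.root j).primWeight a l ∈ A := by
    intro l hl
    rw [LogRoot.primWeight, if_neg hl]
    exact A.mul_mem (A.algebraMap_mem _) (zpow_mem A hdiv (hr j) _)
  obtain ⟨n, rfl | rfl⟩ := n.eq_nat_or_neg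
  · rw [LogRoot.psi_natCast, LogRoot.psiNat, LogRoot.prim,
      weighted_eq_sum _ _ (Nat.lt_succ_self _)]
    refine A.sum_mem fun l _ => ?_
    by_cases hc : (c.divPow k n).coeff l = 0
    · rw [hc, zero_mul]; exact A.zero_mem
    · obtain ⟨u, hu, hul⟩ := c.exists_of_coeff_divPow_ne_zero k hc
      refine A.mul_mem (coeff_divPow_mem A hx n l) (hw l ?_)
      rintro rfl
      exact h.1 u (by rw [← hul]; push_cast; rfl)
  · rw [LogRoot.psi_neg, LogRoot.psiNat_zero]
    exact D_iterate_mem A hD 0 n (hw 0 (by simpa using h.ne_zero.symm))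

include hdiv hx hr hD in
-- The two agree in non-negative degree, and each further `D 0` adds a sum of terms `ψ_j D_0(log
-- ρ_j)` without logarithms.
theorem chi_sub_psiLogSum_mem (hk0 : k 0 = 0) (hk : StrictMono k) {n a : ℤ} (h : IsGap k n a) :
    ρ.chi n a - ρ.psiLogSum n a ∈ A := by
  rcases lt_or_ge n 0 with hn | hn
  · obtain ⟨N, rfl⟩ : ∃ N : ℕ, n = -N - 1 := ⟨(-1 - n).toNat, by omega⟩
    rw [ρ.chi_neg_succ hk0 hk N h]
    have ha := h.ne_zero
    -- The gap condition does not pass to higher degrees, so the induction on `N` keeps only `a ≠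
    -- 0`.
    clear h hn
    have hpsi : ∀ (N : ℕ) j, (ρ.root j).psi (-N) a ∈ A := by
      intro N j
      rw [LogRoot.psi_neg, LogRoot.psiNat_zero, LogRoot.primWeight, if_neg (by simpa using ha.symm)]
      exact D_iterate_mem A hD 0 N
        (A.mul_mem (A.algebraMap_mem _) (zpow_mem A hdiv (hr j) _))
    induction N with
    | zero => simp
    | succ N ih =>
      have h1 := hD 0 _ ih
      rw [map_sub, ρ.D_psiLogSum hk0, ← Function.iterate_succ_apply' (f := c.D 0), hk0] at h1
      have h2 : ρ.psiSumDLog 0 (-N - 1) a ∈ A := by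
        refine A.sum_mem fun j _ => A.mul_mem ?_ (ρ.D_log_mem A hdiv hx hr 0 j)
        have := hpsi (N + 1) j
        push_cast at this
        rwa [neg_add'] at this
      have h3 := A.add_mem h1 h2
      have e : (-N - 1 - 1 : ℤ) = -(N + 1 : ℕ) - 1 := by push_cast; ring
      rw [e] at h3
      convert! h3 using 1
      simp only [Nat.cast_zero, sub_zero]
      ring
  · lift n to ℕ using hn
    rw [chi_natCast, sub_self]
    exact A.zero_mem

include hdiv hx hr hD in
-- The residue combination of `χ` over a long interval is, modulo `A`, `∑ res_l(p) log ρ_l`, where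
-- only `l = i, j` survive. As `∑ ψ_l = 0` gives `res_i(p) = -res_j(p)`, it equals `res_j(p) (log
-- ρ_j - log ρ_i)`, and the non-zero factor lies in `A`.
theorem log_sub_log_mem (hk0 : k 0 = 0) (hk : StrictMono k) (hgcd : Finset.univ.gcd k = 1)
    (hcard : Fintype.card ι = deg k) {n a : ℤ} (h : IsGap k n a) (hchi : ρ.chi n a ∈ A)
    {i j : ι} (hij : j ≠ i) : (ρ.root j).log - (ρ.root i).log ∈ A := by
  classical
  have hu := sub_sum_induction (k := k)
    (p := fun n a => IsGap k n a ∧ ρ.chi n a ∈ A) (by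
      rintro n a i ⟨h1, h2⟩
      refine ⟨h1.sub_single i, ?_⟩
      rw [← ρ.D_chi hk0 hk i h1]
      exact hD i _ h2) ⟨h, hchi⟩
  obtain ⟨M, b, hM⟩ := exists_sub_sum_eq k hk0 hk hgcd n a
  set p := ρ.separating i j M with hp
  have hg : ∀ l ≤ p.natDegree, IsGap k (-((M + 1 : ℕ) : ℤ)) (b - l) ∧
      ρ.chi (-((M + 1 : ℕ) : ℤ)) (b - l) ∈ A := by
    intro l hl
    obtain ⟨u, hu1, hu2⟩ := hM l (by
      have : p.natDegree ≤ _ := ρ.natDegree_separating_le hij M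
      rw [hcard] at this
      omega)
    rw [hu1, hu2]
    exact hu u
  have hpc : ∀ l, p.coeff l ∈ A := by
    have h1 : ∀ (l : ι) (e : ℕ),
        (X - C ((ρ.root l).root : R)) ^ e ∈ Polynomial.lifts A.val.toRingHom := by
      intro l e
      rw [sub_eq_add_neg, ← C_neg]
      exact pow_mem (add_mem (X_mem_lifts _)
        (C_mem_lifts A.val.toRingHom ⟨_, A.neg_mem (hr l)⟩)) e
    have h2 : p ∈ Polynomial.lifts A.val.toRingHom :=
      mul_mem (h1 j M) (prod_mem fun l _ => h1 l (M + 1))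
    intro l
    obtain ⟨a, ha⟩ := (Polynomial.lifts_iff_coeff_lifts p).mp h2 l
    rw [← ha]
    exact a.2
  have h0 : ∑ l, (ρ.root l).res (M + 1) b p = 0 := by
    simp only [LogRoot.res_eq_sum]
    rw [Finset.sum_comm]
    refine Finset.sum_eq_zero fun l hl => ?_
    rw [← Finset.mul_sum]
    have := ρ.psiSum_eq_zero hk0 hk (hg l (Nat.lt_succ_iff.mp (Finset.mem_range.mp hl))).1
    rw [psiSum] at this
    rw [this, mul_zero]
  have h1 : ∑ l, (ρ.root l).res (M + 1) b p * (ρ.root l).log ∈ A := by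
    simp only [LogRoot.res_eq_sum, Finset.sum_mul]
    rw [Finset.sum_comm]
    refine A.sum_mem fun l hl => ?_
    simp only [mul_assoc]
    rw [← Finset.mul_sum]
    obtain ⟨h2, h3⟩ := hg l (Nat.lt_succ_iff.mp (Finset.mem_range.mp hl))
    refine A.mul_mem (hpc l) ?_
    have h4 := A.sub_mem h3 (ρ.chi_sub_psiLogSum_mem A hD hdiv hx hr hk0 hk h2)
    rwa [sub_sub_cancel] at h4
  have hz : ∀ l, l ≠ i ∧ l ≠ j → (ρ.root l).res (M + 1) b p = 0 := fun l hl =>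
    ρ.res_separating_eq_zero hk0 hl.1 hl.2 M b
  rw [Fintype.sum_eq_add i j hij.symm hz] at h0
  rw [Fintype.sum_eq_add i j hij.symm fun l hl => by rw [hz l hl, zero_mul]] at h1
  have h2 : (ρ.root j).res (M + 1) b p ∈ A := by
    rw [LogRoot.res_eq_sum]
    refine A.sum_mem fun l hl => A.mul_mem (hpc l) ?_
    exact ρ.psi_mem A hD hdiv hx hr (hg l (Nat.lt_succ_iff.mp (Finset.mem_range.mp hl))).1 j
  refine hdiv _ _ h2 (ρ.res_separating_ne_zero hk0 i j M b) ?_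
  convert! h1 using 1
  linear_combination -(ρ.root i).log * h0

end Subalgebra

end RootSystem

end Residues

/-! ### Algebraic elements, transcendence of `χ`, and linear independence. -/

section AlgebraicElements

open Polynomial

variable {m : ℕ} {R : Type*} [CommRing R] [Algebra ℂ R]

/-- The subalgebra of polynomials in the coordinates. -/
def Coordinates.polynomials (c : Coordinates m R) : Subalgebra ℂ R :=
  Algebra.adjoin ℂ (Set.range c.x)

theorem Coordinates.x_mem (c : Coordinates m R) (i : Fin (m + 2)) : c.x i ∈ c.polynomials :=
  Algebra.subset_adjoin ⟨i, rfl⟩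

theorem Coordinates.D_mem (c : Coordinates m R) (i : Fin (m + 2)) {a : R}
    (ha : a ∈ c.polynomials) : c.D i a ∈ c.polynomials := by
  rw [polynomials] at ha
  induction ha using Algebra.adjoin_induction with
  | mem x hx =>
    obtain ⟨j, rfl⟩ := hx
    rw [c.D_x]
    split_ifs
    · exact c.polynomials.one_mem
    · exact c.polynomials.zero_mem
  | algebraMap r => rw [Derivation.map_algebraMap]; exact c.polynomials.zero_mem
  | add x y _ _ hx hy => rw [map_add]; exact c.polynomials.add_mem hx hy
  | mul x y hx' hy' hx hy =>
    rw [Derivation.leibniz]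
    exact c.polynomials.add_mem (c.polynomials.mul_mem hx' hy) (c.polynomials.mul_mem hy' hx)

/-- All coordinates but `x i` are constants for `D i`, which reduces several variables to the single
generator in `derivation_eq_zero_of_exp_isAlgebraic`. -/
theorem Coordinates.polynomials_le (c : Coordinates m R) (i : Fin (m + 2)) {a : R}
    (ha : a ∈ c.polynomials) : a ∈ Algebra.adjoin (constants (c.D i)) {c.x i} := by
  rw [polynomials] at ha
  induction ha using Algebra.adjoin_induction with
  | mem x hx =>
    obtain ⟨j, rfl⟩ := hx
    by_cases h : i = j
    · rw [h]; exact Algebra.self_mem_adjoin_singleton _ _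
    · have hc : c.D i (c.x j) = 0 := by rw [c.D_x, if_neg h]
      exact Subalgebra.algebraMap_mem _ (⟨c.x j, hc⟩ : constants (c.D i))
  | algebraMap r =>
    exact Subalgebra.algebraMap_mem _ (algebraMap ℂ (constants (c.D i)) r)
  | add x y _ _ hx hy => exact add_mem hx hy
  | mul x y _ _ hx hy => exact mul_mem hx hy

variable [IsDomain R]

omit [IsDomain R] in
theorem Coordinates.isAlgebraic_adjoin (c : Coordinates m R) (i : Fin (m + 2)) {a : R}
    (ha : IsAlgebraic c.polynomials a) :
    IsAlgebraic (Algebra.adjoin (constants (c.D i)) {c.x i}) a := by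
  obtain ⟨p, hp0, hp⟩ := ha
  let f : c.polynomials →+* Algebra.adjoin (constants (c.D i)) {c.x i} :=
    { toFun := fun a => ⟨a, c.polynomials_le i a.2⟩
      map_one' := rfl
      map_mul' := fun _ _ => rfl
      map_zero' := rfl
      map_add' := fun _ _ => rfl }
  have hf : Function.Injective f := fun a b h => Subtype.ext (Subtype.ext_iff.mp h :)
  refine ⟨p.map f, (Polynomial.map_ne_zero_iff hf).mpr hp0, ?_⟩
  rw [aeval_def, eval₂_map]
  exact hp

/-- The elements that are algebraic over the polynomials in the coordinates. -/
def Coordinates.algebraics (c : Coordinates m R) : Subalgebra ℂ R :=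
  (Subalgebra.algebraicClosure c.polynomials R).restrictScalars ℂ

theorem Coordinates.mem_algebraics {c : Coordinates m R} {a : R} :
    a ∈ c.algebraics ↔ IsAlgebraic c.polynomials a := Iff.rfl

theorem Coordinates.mem_algebraics_of_mem {c : Coordinates m R} {a : R}
    (ha : a ∈ c.polynomials) : a ∈ c.algebraics :=
  isAlgebraic_algebraMap (⟨a, ha⟩ : c.polynomials)

theorem Coordinates.D_mem_algebraics (c : Coordinates m R) (i : Fin (m + 2)) (a : R)
    (ha : a ∈ c.algebraics) : c.D i a ∈ c.algebraics := by
  have : CharZero c.polynomials :=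
    charZero_of_injective_algebraMap (algebraMap ℂ c.polynomials).injective
  exact isAlgebraic_derivation_apply (A := c.polynomials) Subtype.val_injective (c.D i)
    (fun a => Coordinates.mem_algebraics_of_mem (c.D_mem i a.2)) ha

theorem Coordinates.div_mem_algebraics (c : Coordinates m R) (a b : R) (ha : a ∈ c.algebraics)
    (h0 : a ≠ 0) (hab : a * b ∈ c.algebraics) : b ∈ c.algebraics :=
  IsAlgebraic.of_mul (R := c.polynomials) (mem_nonZeroDivisors_of_ne_zero h0) ha hab

namespace LogRoot

variable {c : Coordinates m R} {k : Fin (m + 2) → ℕ}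

theorem root_mem_algebraics (hk' : ∀ i, i ≠ Fin.last (m + 1) → k i < deg k)
    (hx : c.x (Fin.last (m + 1)) ≠ 0) (ρ : LogRoot c k) : (ρ.root : R) ∈ c.algebraics := by
  let p : c.polynomials[X] := ∑ j, monomial (k j) ⟨c.x j, c.x_mem j⟩
  refine ⟨p, fun hp => hx ?_, ?_⟩
  · have h := congrArg (fun q => (q.coeff (deg k) : R)) hp
    simp only [p, finsetSum_coeff, coeff_monomial] at h
    rw [Finset.sum_eq_single (Fin.last (m + 1))] at h
    · simpa [deg] using h
    · intro j _ hj
      rw [if_neg (hk' j hj).ne]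
    · simp
  · simp only [p, map_sum, aeval_monomial]
    exact ρ.isRoot

omit [IsDomain R] in
-- Since `D_i(log ρ) = -ρ^(k_i - 1) / f'(ρ)`, dividing by the case `i = 0` gives `(ρ/σ)^(k_i) = 1`
-- for every `i`; the exponents have greatest common divisor one.
theorem root_eq_of_D_log_eq (hk0 : k 0 = 0) (hgcd : Finset.univ.gcd k = 1) (ρ σ : LogRoot c k)
    (h : ∀ i, c.D i ρ.log = c.D i σ.log) : ρ.root = σ.root := by
  have h1 : ∀ i, ρ.root ^ ((k i : ℤ) - 1) * ρ.der⁻¹ = σ.root ^ ((k i : ℤ) - 1) * σ.der⁻¹ := by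
    intro i
    have := h i
    rw [D_log_eq, D_log_eq, neg_inj] at this
    exact Units.ext this
  have h2 : ∀ i, (ρ.root / σ.root) ^ k i = 1 := by
    intro i
    have e0 := h1 0
    have ei := h1 i
    rw [hk0, Nat.cast_zero, zero_sub] at e0
    rw [show (k i : ℤ) - 1 = k i + -1 by ring, zpow_add, zpow_add, mul_assoc, mul_assoc, e0,
      zpow_natCast, zpow_natCast] at ei
    rw [div_pow, mul_right_cancel ei, div_self']
  have h3 : orderOf (ρ.root / σ.root) ∣ 1 := by
    rw [← hgcd]
    exact Finset.dvd_gcd fun i _ => orderOf_dvd_of_pow_eq_one (h2 i)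
  exact div_eq_one.mp (orderOf_eq_one_iff.mp (Nat.dvd_one.mp h3))

end LogRoot

namespace RootSystem

variable {c : Coordinates m R} {k : Fin (m + 2) → ℕ} {ι : Type*} [Fintype ι]
  (ρ : RootSystem c k ι)

theorem root_mem_algebraics (hk : StrictMono k) (j : ι) :
    ((ρ.root j).root : R) ∈ c.algebraics :=
  (ρ.root j).root_mem_algebraics
    (fun i hi => hk (lt_of_le_of_ne (Fin.le_last i) hi)) ρ.x_last_ne

/-- The quotient `ρ_j / ρ_i` is algebraic and plays the exponential of the difference of logarithms,
so all derivatives of the difference would vanish and the roots would coincide. -/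
theorem log_sub_log_notMem (hk0 : k 0 = 0) (hk : StrictMono k) (hgcd : Finset.univ.gcd k = 1)
    {i j : ι} (hij : j ≠ i) : (ρ.root j).log - (ρ.root i).log ∉ c.algebraics := by
  intro h
  refine ρ.injective j i hij (congrArg Units.val
    (LogRoot.root_eq_of_D_log_eq hk0 hgcd (ρ.root j) (ρ.root i) fun l => ?_))
  set w : Rˣ := (ρ.root j).root * (ρ.root i).root⁻¹ with hw
  have hwa : (w : R) ∈ c.algebraics := by
    rw [hw, Units.val_mul]
    exact mul_mem (ρ.root_mem_algebraics hk j)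
      (inv_mem _ c.div_mem_algebraics (ρ.root_mem_algebraics hk i))
  have hexp : c.D l w = w * c.D l ((ρ.root j).log - (ρ.root i).log) := by
    have h1 := (ρ.root j).D_zpow l 1
    have h2 := (ρ.root i).D_zpow l (-1)
    rw [zpow_one] at h1
    rw [zpow_neg_one] at h2
    rw [hw, Units.val_mul, Derivation.leibniz, h1, h2, map_sub]
    simp only [smul_eq_mul]
    push_cast
    ring
  have := derivation_eq_zero_of_exp_isAlgebraic (c.D l) w.ne_zero hexp
    (c.isAlgebraic_adjoin l h) (c.isAlgebraic_adjoin l hwa)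
  rwa [map_sub, sub_eq_zero] at this

theorem chi_notMem_algebraics (hk0 : k 0 = 0) (hk : StrictMono k)
    (hgcd : Finset.univ.gcd k = 1) (hd : 1 < deg k) (hcard : Fintype.card ι = deg k) {n a : ℤ}
    (h : IsGap k n a) : ρ.chi n a ∉ c.algebraics := by
  intro hchi
  obtain ⟨i, j, hij⟩ := Fintype.exists_pair_of_one_lt_card (hcard.symm ▸ hd)
  exact ρ.log_sub_log_notMem hk0 hk hgcd hij.symm (ρ.log_sub_log_mem c.algebraics
    c.D_mem_algebraics c.div_mem_algebraics
    (fun i => Coordinates.mem_algebraics_of_mem (c.x_mem i)) (ρ.root_mem_algebraics hk)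
    hk0 hk hgcd hcard h hchi hij.symm)

/-- The `ψ_j` are algebraic and `χ` is not, so `χ` has coefficient zero. What remains is a relation
among all `d` functions `ψ_j` in which the last root has coefficient zero. -/
theorem linearIndependent_psi_chi (ρ : RootSystem c k (Fin (deg k))) (hk0 : k 0 = 0)
    (hk : StrictMono k) (hgcd : Finset.univ.gcd k = 1) (hd : 1 < deg k) {n a : ℤ}
    (h : IsGap k n a) :
    LinearIndependent ℂ (Sum.elim
      (fun j : Fin (deg k - 1) => (ρ.root (Fin.castLE (Nat.sub_le _ 1) j)).psi n a)
      (fun _ : Unit => ρ.chi n a)) := by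
  rw [Fintype.linearIndependent_iff]
  intro g hg
  simp only [Fintype.sum_sum_type, Sum.elim_inl, Sum.elim_inr, Finset.univ_unique,
    Finset.sum_singleton, Algebra.smul_def] at hg
  have hchi : g (Sum.inr ()) = 0 := by
    by_contra h0
    refine ρ.chi_notMem_algebraics hk0 hk hgcd hd (Fintype.card_fin _) h ?_
    have h1 : algebraMap ℂ R (g (Sum.inr ())) * ρ.chi n a ∈ c.algebraics := by
      rw [eq_neg_of_add_eq_zero_right hg]
      refine neg_mem (sum_mem fun j _ => mul_mem (Subalgebra.algebraMap_mem _ _) ?_)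
      exact ρ.psi_mem c.algebraics
        c.D_mem_algebraics c.div_mem_algebraics
        (fun i => Coordinates.mem_algebraics_of_mem (c.x_mem i)) (ρ.root_mem_algebraics hk)
        h _
    refine c.div_mem_algebraics _ _ (Subalgebra.algebraMap_mem _ _) ?_ h1
    simpa using h0
  rw [hchi, map_zero, zero_mul, add_zero] at hg
  set s : Fin (deg k) → ℂ := fun j => if hj : (j : ℕ) < deg k - 1 then g (Sum.inl ⟨j, hj⟩) else 0
  have hs : ∑ j, algebraMap ℂ R (s j) * (ρ.root j).psi n a = 0 := by
    rw [← hg]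
    symm
    refine Fintype.sum_of_injective (Fin.castLE (Nat.sub_le _ 1)) (Fin.castLE_injective _) _ _ ?_ ?_
    · intro j hj
      have : ¬ (j : ℕ) < deg k - 1 := fun h => hj ⟨⟨j, h⟩, rfl⟩
      simp [s, this]
    · intro j
      simp [s]
  have hall := ρ.coefficient_eq_zero hk0 hk hgcd (Fintype.card_fin _)
    (i := ⟨deg k - 1, by omega⟩) (by simp [s]) hs
  rintro (j | ⟨⟩)
  · simpa [s] using hall (Fin.castLE (Nat.sub_le _ 1) j)
  · exact hchi

end RootSystem

end AlgebraicElements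

/-! ### The differential domain of analytic functions on a connected open set. -/

section AnalyticAlgebra

open Topology ContDiff

section Holomorphic

variable {n : ℕ} {U : Set (Fin n → ℂ)}

theorem pd_analyticOnNhd {g : (Fin n → ℂ) → ℂ} (hg : AnalyticOnNhd ℂ g U) (j : Fin n) :
    AnalyticOnNhd ℂ (pd j g) U :=
  (ContinuousLinearMap.apply ℂ ℂ (Pi.single j 1 : Fin n → ℂ)).comp_analyticOnNhd hg.fderiv

theorem pd_eqOn (hU : IsOpen U) {f g : (Fin n → ℂ) → ℂ} (h : Set.EqOn f g U) (j : Fin n) :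
    Set.EqOn (pd j f) (pd j g) U := fun x hx => by
  have : f =ᶠ[𝓝 x] g := Filter.eventuallyEq_of_mem (hU.mem_nhds hx) h
  rw [pd, pd, this.fderiv_eq]

theorem pd_comm {g : (Fin n → ℂ) → ℂ} (hg : AnalyticOnNhd ℂ g U) (i j : Fin n) {x : Fin n → ℂ}
    (hx : x ∈ U) : pd i (pd j g) x = pd j (pd i g) x := by
  have hd : DifferentiableAt ℂ (fderiv ℂ g) x := (hg.fderiv x hx).differentiableAt
  have h : ∀ v w : Fin n → ℂ,
      fderiv ℂ (fun y => fderiv ℂ g y v) x w = fderiv ℂ (fderiv ℂ g) x w v := by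
    intro v w
    rw [fderiv_clm_apply hd (differentiableAt_const v)]
    simp
  have hs := (hg x hx).contDiffAt.isSymmSndFDerivAt_of_omega
  rw [pd, pd]
  exact (h _ _).trans ((hs.eq _ _).trans (h _ _).symm)

variable (U) in
/-- The algebra of analytic functions on `U`. -/
def analyticAlgebra : Subalgebra ℂ (U → ℂ) where
  carrier := {φ | ∃ g : (Fin n → ℂ) → ℂ, AnalyticOnNhd ℂ g U ∧ ∀ x : U, φ x = g x}
  mul_mem' := by
    rintro _ _ ⟨f, hf, hf'⟩ ⟨g, hg, hg'⟩
    exact ⟨_, hf.mul hg, fun x => by simp [hf', hg']⟩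
  add_mem' := by
    rintro _ _ ⟨f, hf, hf'⟩ ⟨g, hg, hg'⟩
    exact ⟨_, hf.add hg, fun x => by simp [hf', hg']⟩
  algebraMap_mem' := fun r => ⟨fun _ => r, analyticOnNhd_const, fun x => rfl⟩

namespace analyticAlgebra

/-- The restriction to `U` of a function that is analytic on `U`. -/
def of (g : (Fin n → ℂ) → ℂ) (hg : AnalyticOnNhd ℂ g U) : analyticAlgebra U :=
  ⟨fun x => g x, g, hg, fun _ => rfl⟩

/-- An extension of an element of the algebra. -/
def ext (φ : analyticAlgebra U) : (Fin n → ℂ) → ℂ := φ.2.choose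

theorem ext_analyticOnNhd (φ : analyticAlgebra U) : AnalyticOnNhd ℂ (ext φ) U :=
  φ.2.choose_spec.1

theorem ext_apply (φ : analyticAlgebra U) (x : U) : ext φ x = φ.1 x :=
  (φ.2.choose_spec.2 x).symm

/-- Evaluation at a point of `U`. -/
def eval (x : U) : analyticAlgebra U →ₐ[ℂ] ℂ :=
  (Pi.evalAlgHom ℂ (fun _ : U => ℂ) x).comp (analyticAlgebra U).val

theorem eval_of {g : (Fin n → ℂ) → ℂ} (hg : AnalyticOnNhd ℂ g U) (x : U) :
    eval x (of g hg) = g x := rfl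

theorem eval_ext {φ χ : analyticAlgebra U} (h : ∀ x, eval x φ = eval x χ) : φ = χ :=
  Subtype.ext (funext h)

theorem ext_eqOn {φ : analyticAlgebra U} {g : (Fin n → ℂ) → ℂ} (h : ∀ x : U, eval x φ = g x) :
    Set.EqOn (ext φ) g U := fun x hx => (ext_apply φ ⟨x, hx⟩).trans (h ⟨x, hx⟩)

variable (hU : IsOpen U)

/-- The partial derivatives on the algebra of analytic functions. -/
def D (j : Fin n) : Derivation ℂ (analyticAlgebra U) (analyticAlgebra U) :=
  Derivation.mk'
    { toFun := fun φ => of (pd j (ext φ)) (pd_analyticOnNhd (ext_analyticOnNhd φ) j)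
      map_add' := fun φ χ => eval_ext fun x => by
        have h : Set.EqOn (ext (φ + χ)) (ext φ + ext χ) U := ext_eqOn fun x => by
          rw [map_add, Pi.add_apply, ext_apply, ext_apply]; rfl
        rw [eval_of, map_add, eval_of, eval_of, pd_eqOn hU h j x.2, pd,
          fderiv_add (ext_analyticOnNhd φ x x.2).differentiableAt
            (ext_analyticOnNhd χ x x.2).differentiableAt]
        rfl
      map_smul' := fun r φ => eval_ext fun x => by
        have h : Set.EqOn (ext (r • φ)) (r • ext φ) U := ext_eqOn fun x => by
          rw [map_smul, Pi.smul_apply, ext_apply]; rfl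
        rw [eval_of, RingHom.id_apply, map_smul, eval_of, pd_eqOn hU h j x.2, pd,
          fderiv_const_smul (ext_analyticOnNhd φ x x.2).differentiableAt]
        rfl }
    fun φ χ => eval_ext fun x => by
      have h : Set.EqOn (ext (φ * χ)) (ext φ * ext χ) U := ext_eqOn fun x => by
        rw [map_mul, Pi.mul_apply, ext_apply, ext_apply]; rfl
      simp only [LinearMap.coe_mk, AddHom.coe_mk, smul_eq_mul, map_add, map_mul, eval_of]
      rw [pd_eqOn hU h j x.2, pd, fderiv_mul (ext_analyticOnNhd φ x x.2).differentiableAt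
        (ext_analyticOnNhd χ x x.2).differentiableAt, ext_apply, ext_apply]
      rfl

theorem eval_D {φ : analyticAlgebra U} {g : (Fin n → ℂ) → ℂ} (h : ∀ x : U, eval x φ = g x)
    (j : Fin n) (x : U) : eval x (D hU j φ) = pd j g x :=
  pd_eqOn hU (ext_eqOn h) j x.2

theorem D_comm (i j : Fin n) (φ : analyticAlgebra U) : D hU i (D hU j φ) = D hU j (D hU i φ) := by
  refine eval_ext fun x => ?_
  have h : ∀ i j, eval x (D hU i (D hU j φ)) = pd i (pd j (ext φ)) x := fun i j =>
    eval_D hU (fun y => eval_D hU (fun z => (ext_apply φ z).symm) j y) i x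
  rw [h, h, pd_comm (ext_analyticOnNhd φ) i j x.2]

theorem eval_D_iterate {φ : analyticAlgebra U} {g : (Fin n → ℂ) → ℂ}
    (h : ∀ x : U, eval x φ = g x) (j : Fin n) (N : ℕ) (x : U) :
    eval x ((D hU j)^[N] φ) = (pd j)^[N] g x := by
  induction N generalizing x with
  | zero => exact h x
  | succ N ih =>
    rw [Function.iterate_succ_apply', Function.iterate_succ_apply']
    exact eval_D hU ih j x

/-- The operator `D_u` on the algebra of analytic functions. -/
def DMulti (u : Fin n → ℕ) (φ : analyticAlgebra U) : analyticAlgebra U :=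
  (List.finRange n).foldr (fun j g => (D hU j)^[u j] g) φ

theorem eval_DMulti {φ : analyticAlgebra U} {g : (Fin n → ℂ) → ℂ}
    (h : ∀ x : U, eval x φ = g x) (u : Fin n → ℕ) (x : U) :
    eval x (DMulti hU u φ) = pdMulti u g x := by
  rw [DMulti, pdMulti]
  induction List.finRange n generalizing x with
  | nil => exact h x
  | cons j l ih => exact eval_D_iterate hU ih j (u j) x

include hU in
-- Where one factor is non-zero the other vanishes on a neighbourhood, hence on all of `U` by the
-- identity theorem.
theorem noZeroDivisors (hc : IsPreconnected U) : NoZeroDivisors (analyticAlgebra U) where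
  eq_zero_or_eq_zero_of_mul_eq_zero := by
    intro φ χ h
    by_contra! h0
    obtain ⟨x, hx⟩ : ∃ x, eval x φ ≠ 0 := by
      by_contra! h1
      exact h0.1 (eval_ext fun x => by rw [h1, map_zero])
    have h1 : ∀ᶠ y in 𝓝 (x : Fin n → ℂ), ext φ y ≠ 0 :=
      (ext_analyticOnNhd φ x x.2).continuousAt.eventually_ne (by rwa [ext_apply])
    have h2 : ext χ =ᶠ[𝓝 (x : Fin n → ℂ)] 0 := by
      filter_upwards [h1, hU.mem_nhds x.2] with y hy hyU
      have h3 := congrArg (eval ⟨y, hyU⟩) h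
      rw [map_mul, map_zero] at h3
      rw [ext_apply φ ⟨y, hyU⟩] at hy
      exact (ext_apply χ ⟨y, hyU⟩).trans ((mul_eq_zero.mp h3).resolve_left hy)
    have h3 := (ext_analyticOnNhd χ).eqOn_zero_of_preconnected_of_eventuallyEq_zero hc x.2 h2
    exact h0.2 (eval_ext fun y => by rw [map_zero]; exact (ext_apply χ y).symm.trans (h3 y.2))

include hU in
theorem isDomain (hc : IsPreconnected U) (hne : U.Nonempty) : IsDomain (analyticAlgebra U) := by
  have := noZeroDivisors hU hc
  have : Nonempty U := hne.to_subtype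
  have : Nontrivial (analyticAlgebra U) := inferInstance
  exact NoZeroDivisors.to_isDomain _

/-- A nowhere vanishing analytic function as a unit. -/
def unitOf (g : (Fin n → ℂ) → ℂ) (hg : AnalyticOnNhd ℂ g U) (h0 : ∀ x ∈ U, g x ≠ 0) :
    (analyticAlgebra U)ˣ where
  val := of g hg
  inv := of g⁻¹ (hg.inv h0)
  val_inv := eval_ext fun x => by
    rw [map_mul, map_one, eval_of, eval_of, Pi.inv_apply, mul_inv_cancel₀ (h0 x x.2)]
  inv_val := eval_ext fun x => by
    rw [map_mul, map_one, eval_of, eval_of, Pi.inv_apply, inv_mul_cancel₀ (h0 x x.2)]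

theorem eval_unitOf {g : (Fin n → ℂ) → ℂ} (hg : AnalyticOnNhd ℂ g U) (h0 : ∀ x ∈ U, g x ≠ 0)
    (x : U) : eval x (unitOf g hg h0 : analyticAlgebra U) = g x := rfl

theorem eval_unit_inv (u : (analyticAlgebra U)ˣ) (x : U) :
    eval x ((u⁻¹ : (analyticAlgebra U)ˣ) : analyticAlgebra U) = (eval x (u : analyticAlgebra U))⁻¹ :=
  eq_inv_of_mul_eq_one_left (by rw [← map_mul, Units.inv_mul, map_one])

theorem eval_unit_zpow (u : (analyticAlgebra U)ˣ) (l : ℤ) (x : U) :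
    eval x ((u ^ l : (analyticAlgebra U)ˣ) : analyticAlgebra U) =
      eval x (u : analyticAlgebra U) ^ l := by
  obtain ⟨l, rfl | rfl⟩ := l.eq_nat_or_neg
  · rw [zpow_natCast, zpow_natCast, Units.val_pow_eq_pow_val, map_pow]
  · rw [zpow_neg, zpow_natCast, eval_unit_inv, zpow_neg, zpow_natCast, Units.val_pow_eq_pow_val,
      map_pow]

theorem analyticOnNhd_coord (j : Fin n) : AnalyticOnNhd ℂ (fun x : Fin n → ℂ => x j) U :=
  (ContinuousLinearMap.proj (R := ℂ) (φ := fun _ : Fin n => ℂ) j).analyticOnNhd U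

/-- The coordinate functions. -/
def coord (j : Fin n) : analyticAlgebra U := of (fun x => x j) (analyticOnNhd_coord j)

theorem D_coord (i j : Fin n) : D hU i (coord j) = if i = j then 1 else 0 := by
  refine eval_ext fun x => ?_
  rw [eval_D hU (g := fun x => x j) (fun x => rfl), pd,
    show (fun x : Fin n → ℂ => x j) =
      ContinuousLinearMap.proj (R := ℂ) (φ := fun _ : Fin n => ℂ) j from rfl,
    ContinuousLinearMap.fderiv, ContinuousLinearMap.proj_apply, Pi.single_apply]
  simp only [eq_comm (a := j)]
  split_ifs <;> simp

/-- An open set contains a product of discs, and a polynomial is determined by its values on a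
product of infinite sets. -/
theorem aeval_coord_injective (hU : IsOpen U) (hne : U.Nonempty) :
    Function.Injective (MvPolynomial.aeval (coord (U := U)) : MvPolynomial (Fin n) ℂ →ₐ[ℂ] _) := by
  obtain ⟨x, hx⟩ := hne
  obtain ⟨ε, hε, hball⟩ := Metric.isOpen_iff.mp hU x hx
  intro p q h
  have hinf : ∀ i, (Metric.ball (x i) ε).Infinite := fun i =>
    infinite_of_mem_nhds (x i) (Metric.ball_mem_nhds _ hε)
  refine MvPolynomial.funext_set (fun i => Metric.ball (x i) ε) hinf fun y hy => ?_
  have hyU : y ∈ U := hball (by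
    rw [ball_pi x hε]
    exact hy)
  have he : ∀ p, eval ⟨y, hyU⟩ (MvPolynomial.aeval coord p) = MvPolynomial.eval y p := by
    intro p
    rw [← MvPolynomial.aeval_eq_eval]
    have : (eval ⟨y, hyU⟩).comp (MvPolynomial.aeval coord) = MvPolynomial.aeval (R := ℂ) y :=
      MvPolynomial.algHom_ext fun i => by simp [coord, eval_of]
    exact DFunLike.congr_fun this p
  rw [← he, ← he, h]

end analyticAlgebra

end Holomorphic

end AnalyticAlgebra

/-! ### Analytic roots and logarithms, and the passage back to functions on `U`. -/

section AnalyticRoots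

open Topology ContDiff Polynomial

variable {m : ℕ} {k : Fin (m + 2) → ℕ}

theorem eval_genericPoly (x : Fin (m + 2) → ℂ) (t : ℂ) :
    (genericPoly k x).eval t = ∑ j, x j * t ^ k j := by
  simp [genericPoly, eval_finsetSum]

theorem eval_derivative_genericPoly (x : Fin (m + 2) → ℂ) (t : ℂ) :
    (derivative (genericPoly k x)).eval t = ∑ j, x j * k j * t ^ (k j - 1) := by
  simp [genericPoly, eval_finsetSum, derivative_monomial]

/-- At a simple root the equation `f(x; t) = 0` has a unique continuous local solution, the implicit
function, which is analytic. -/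
theorem analyticAt_root {ρ : (Fin (m + 2) → ℂ) → ℂ} {x₀ : Fin (m + 2) → ℂ}
    (hc : ContinuousAt ρ x₀) (h : ∀ᶠ x in 𝓝 x₀, (genericPoly k x).eval (ρ x) = 0)
    (hd : (derivative (genericPoly k x₀)).eval (ρ x₀) ≠ 0) : AnalyticAt ℂ ρ x₀ := by
  set f : (Fin (m + 2) → ℂ) × ℂ → ℂ := fun p => ∑ j, p.1 j * p.2 ^ k j with hf
  have hcd : ContDiff ℂ ω f := by fun_prop
  have hcda : ContDiffAt ℂ ω f (x₀, ρ x₀) := hcd.contDiffAt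
  have hinv : (fderiv ℂ f (x₀, ρ x₀) ∘L .inr ℂ (Fin (m + 2) → ℂ) ℂ).IsInvertible := by
    refine ⟨ContinuousLinearEquiv.unitsEquivAut ℂ (Units.mk0 _ hd), ?_⟩
    ext
    have h1 : HasFDerivAt f (fderiv ℂ f (x₀, ρ x₀)) (x₀, ρ x₀) :=
      (hcda.differentiableAt (by simp)).hasFDerivAt
    have h2 : HasDerivAt (fun t : ℂ => (x₀, t)) ((0 : Fin (m + 2) → ℂ), (1 : ℂ)) (ρ x₀) :=
      (hasDerivAt_const _ _).prodMk (hasDerivAt_id _)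
    have h3 := h1.comp_hasDerivAt (ρ x₀) h2
    have h4 : f ∘ (fun t : ℂ => (x₀, t)) = fun t => (genericPoly k x₀).eval t := by
      ext t
      rw [eval_genericPoly]
      rfl
    rw [h4] at h3
    have h5 := h3.unique ((genericPoly k x₀).hasDerivAt (ρ x₀))
    simp [h5]
  have hρ : Filter.Tendsto (fun x => (x, ρ x)) (𝓝 x₀) (𝓝 (x₀, ρ x₀)) :=
    (continuousAt_id.prodMk hc)
  have h1 := hρ.eventually (hcda.eventually_apply_eq_iff_implicitFunction (by simp) hinv)
  have h0 : f (x₀, ρ x₀) = 0 := by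
    have := h.self_of_nhds
    rwa [eval_genericPoly] at this
  have h2 : ρ =ᶠ[𝓝 x₀] hcda.implicitFunction (by simp) hinv := by
    filter_upwards [h1, h] with x hx hx'
    rw [eval_genericPoly] at hx'
    exact (hx.mp (by rw [h0]; exact hx')).symm
  exact ((hcda.contDiffAt_implicitFunction (by simp) hinv).congr_of_eventuallyEq h2).analyticAt

/-- Locally `L = L(x₀) + Log(ρ / ρ(x₀))`: by continuity `L - L(x₀)` has norm below `1`, hence
imaginary part within `(-π, π)`. -/
theorem analyticAt_of_exp_eq {E : Type*} [NormedAddCommGroup E] [NormedSpace ℂ E] {L ρ : E → ℂ}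
    {x₀ : E} (hc : ContinuousAt L x₀) (hρ : AnalyticAt ℂ ρ x₀)
    (h : ∀ᶠ x in 𝓝 x₀, Complex.exp (L x) = ρ x) : AnalyticAt ℂ L x₀ := by
  have hne : ρ x₀ ≠ 0 := by rw [← h.self_of_nhds]; exact Complex.exp_ne_zero _
  have h1 : AnalyticAt ℂ (fun x => Complex.log (ρ x / ρ x₀) + L x₀) x₀ := by
    refine AnalyticAt.add (AnalyticAt.clog (hρ.div analyticAt_const hne) ?_) analyticAt_const
    rw [div_self hne]
    exact Complex.one_mem_slitPlane
  refine h1.congr ?_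
  have h2 : ∀ᶠ x in 𝓝 x₀, ‖L x - L x₀‖ < 1 := by
    have : Filter.Tendsto (fun x => ‖L x - L x₀‖) (𝓝 x₀) (𝓝 0) := by
      have := (hc.sub (continuousAt_const (y := L x₀))).norm
      simpa [ContinuousAt] using this
    exact this.eventually_lt_const one_pos
  filter_upwards [h, h2] with x hx hx2
  rw [← hx, ← h.self_of_nhds, ← Complex.exp_sub, Complex.log_exp, sub_add_cancel]
  · have := (abs_le.mp ((Complex.abs_im_le_norm _).trans hx2.le)).1
    linarith [Real.pi_gt_three]
  · have := (abs_le.mp ((Complex.abs_im_le_norm _).trans hx2.le)).2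
    linarith [Real.pi_gt_three]

section Pointwise

variable (hk : StrictMono k) {x : Fin (m + 2) → ℂ}
  (hx : x (Fin.last (m + 1)) ≠ 0) {r : Fin (deg k) → ℂ}
  (hr : ∀ j, (genericPoly k x).eval (r j) = 0) (hinj : Function.Injective r)

include hk in
theorem coeff_genericPoly_deg (x : Fin (m + 2) → ℂ) :
    (genericPoly k x).coeff (deg k) = x (Fin.last (m + 1)) := by
  rw [genericPoly, finsetSum_coeff, Finset.sum_eq_single (Fin.last (m + 1))]
  · simp [deg]
  · intro j _ hj
    have hlt : k j < deg k := hk (lt_of_le_of_ne (Fin.le_last j) hj)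
    rw [coeff_monomial, if_neg hlt.ne]
  · simp

include hk in
theorem degree_genericPoly_le (x : Fin (m + 2) → ℂ) : (genericPoly k x).degree ≤ deg k := by
  refine (degree_sum_le _ _).trans (Finset.sup_le fun j _ => ?_)
  exact (degree_monomial_le _ _).trans (by exact_mod_cast hk.monotone (Fin.le_last j))

include hk hx hr hinj in
theorem genericPoly_eq_nodal :
    genericPoly k x = C (x (Fin.last (m + 1))) * Lagrange.nodal Finset.univ r := by
  have hdeg : (genericPoly k x).degree = deg k :=
    le_antisymm (degree_genericPoly_le hk x)
      (le_degree_of_ne_zero (by rwa [coeff_genericPoly_deg hk]))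
  have hlc : (genericPoly k x).leadingCoeff = x (Fin.last (m + 1)) := by
    rw [leadingCoeff, natDegree_eq_of_degree_eq_some hdeg, coeff_genericPoly_deg hk]
  refine eq_of_degree_le_of_eval_index_eq Finset.univ hinj.injOn ?_ ?_ ?_ ?_
  · rw [hdeg]; simp
  · rw [hdeg, degree_C_mul hx, Lagrange.degree_nodal]; simp
  · rw [hlc, leadingCoeff_mul, leadingCoeff_C, Lagrange.nodal_monic.leadingCoeff, mul_one]
  · intro j _
    rw [hr, eval_mul, Lagrange.eval_nodal_at_node (Finset.mem_univ j), mul_zero]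

include hk hx hr hinj in
theorem eval_derivative_genericPoly_root (j : Fin (deg k)) :
    (derivative (genericPoly k x)).eval (r j) =
      x (Fin.last (m + 1)) * ∏ l ∈ Finset.univ.erase j, (r j - r l) := by
  rw [genericPoly_eq_nodal hk hx hr hinj, derivative_C_mul, eval_mul, eval_C,
    Lagrange.eval_nodal_derivative_eval_node_eq (Finset.mem_univ j), Lagrange.eval_nodal]

include hk hx hr hinj in
theorem eval_derivative_genericPoly_ne_zero (j : Fin (deg k)) :
    (derivative (genericPoly k x)).eval (r j) ≠ 0 := by
  rw [eval_derivative_genericPoly_root hk hx hr hinj]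
  refine mul_ne_zero hx (Finset.prod_ne_zero_iff.mpr fun l hl => sub_ne_zero.mpr fun h => ?_)
  exact Finset.ne_of_mem_erase hl (hinj h).symm

include hk hx hr hinj in
-- Interpolating `t^s` at the `d` roots reproduces it as `s < d`; the sum is, by Lagrange's formula,
-- its coefficient at `t^(d-1)`.
theorem sum_pow_div_derivative {s : ℕ} (hs : s < deg k) :
    x (Fin.last (m + 1)) * ∑ j, r j ^ s * ((derivative (genericPoly k x)).eval (r j))⁻¹ =
      if s + 1 = deg k then 1 else 0 := by
  have h := Lagrange.coeff_eq_sum (s := Finset.univ) (v := r) hinj.injOn (P := (X ^ s : ℂ[X])) (by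
    rw [degree_X_pow]; simpa using hs)
  simp only [eval_pow, eval_X, coeff_X_pow, Finset.card_univ, Fintype.card_fin] at h
  have e : (deg k - 1 = s) = (s + 1 = deg k) := by
    apply propext; omega
  simp only [e] at h
  rw [h, Finset.mul_sum]
  refine Finset.sum_congr rfl fun j _ => ?_
  rw [eval_derivative_genericPoly_root hk hx hr hinj, mul_inv]
  field_simp

end Pointwise

open analyticAlgebra

variable {U : Set (Fin (m + 2) → ℂ)}

/-- The coordinates on an open set. -/
def coordinatesOn (hU : IsOpen U) : Coordinates m (analyticAlgebra U) where
  D := D hU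
  x := coord
  comm := D_comm hU
  D_x := D_coord hU

/-- The analytic root `ρ` with logarithm `L` as an abstract root over the analytic functions. -/
def logRootOn (k : Fin (m + 2) → ℕ) (hU : IsOpen U) {ρ L : (Fin (m + 2) → ℂ) → ℂ}
    (hρ : AnalyticOnNhd ℂ ρ U)
    (hL : AnalyticOnNhd ℂ L U) (hroot : ∀ x ∈ U, (genericPoly k x).eval (ρ x) = 0)
    (hder : ∀ x ∈ U, (derivative (genericPoly k x)).eval (ρ x) ≠ 0)
    (hlog : ∀ x ∈ U, Complex.exp (L x) = ρ x) : LogRoot (coordinatesOn hU) k where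
  root := unitOf ρ hρ fun x hx => by rw [← hlog x hx]; exact Complex.exp_ne_zero _
  der := unitOf (fun x => (derivative (genericPoly k x)).eval (ρ x)) (by
    intro x hx
    have h := hρ x hx
    simp only [eval_derivative_genericPoly]
    refine Finset.analyticAt_fun_sum _ fun j _ => ?_
    exact ((analyticOnNhd_coord j x hx).mul analyticAt_const).mul (h.pow _)) hder
  log := of L hL
  isRoot := eval_ext fun x => by
    have := hroot x x.2
    rw [eval_genericPoly] at this
    simp only [map_sum, map_mul, map_pow, map_zero, eval_unitOf]
    exact this
  der_eq := eval_ext fun x => by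
    simp only [map_sum, map_mul, map_pow, map_natCast, eval_unitOf, eval_derivative_genericPoly,
      Finset.mul_sum]
    refine Finset.sum_congr rfl fun j _ => ?_
    rw [show eval x ((coordinatesOn hU).x j) = (x : Fin (m + 2) → ℂ) j from rfl]
    rcases k j with _ | l
    · simp
    · simp only [Nat.add_sub_cancel]; ring
  D_log := fun i => eval_ext fun x => by
    have h1 : eval x ((coordinatesOn hU).D i (of L hL)) = pd i L x :=
      eval_D hU (fun y => rfl) i x
    have h2 : eval x ((coordinatesOn hU).D i (of ρ hρ)) = pd i ρ x :=
      eval_D hU (fun y => rfl) i x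
    have h3 : Set.EqOn ρ (fun y => Complex.exp (L y)) U := fun y hy => (hlog y hy).symm
    rw [map_mul, h1, eval_unitOf]
    refine Eq.trans ?_ h2.symm
    rw [pd_eqOn hU h3 i x.2, pd, pd, (hL x x.2).differentiableAt.hasFDerivAt.cexp.fderiv,
      hlog x x.2]
    rfl

/-- The hypotheses on the roots and their logarithms, with analyticity. -/
structure RootsOn (k : Fin (m + 2) → ℕ) (U : Set (Fin (m + 2) → ℂ))
    (ρ L : Fin (deg k) → (Fin (m + 2) → ℂ) → ℂ) : Prop where
  isOpen : IsOpen U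
  nonempty : U.Nonempty
  zero_ne : ∀ x ∈ U, x 0 ≠ 0
  last_ne : ∀ x ∈ U, x (Fin.last (m + 1)) ≠ 0
  root_analytic : ∀ j, AnalyticOnNhd ℂ (ρ j) U
  log_analytic : ∀ j, AnalyticOnNhd ℂ (L j) U
  root_eval : ∀ j, ∀ x ∈ U, (genericPoly k x).eval (ρ j x) = 0
  exp_log : ∀ j, ∀ x ∈ U, Complex.exp (L j x) = ρ j x
  injective : ∀ x ∈ U, Function.Injective (fun j => ρ j x)
  strictMono : StrictMono k

namespace RootsOn

variable {ρ L : Fin (deg k) → (Fin (m + 2) → ℂ) → ℂ} (h : RootsOn k U ρ L)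

include h

theorem der_ne (j : Fin (deg k)) (x : Fin (m + 2) → ℂ) (hx : x ∈ U) :
    (derivative (genericPoly k x)).eval (ρ j x) ≠ 0 :=
  eval_derivative_genericPoly_ne_zero h.strictMono (h.last_ne x hx) (fun j => h.root_eval j x hx)
    (h.injective x hx) j

/-- The root `ρ j` over the algebra of analytic functions. -/
def logRoot (j : Fin (deg k)) : LogRoot (coordinatesOn h.isOpen) k :=
  logRootOn k h.isOpen (h.root_analytic j) (h.log_analytic j) (h.root_eval j) (h.der_ne j)
    (h.exp_log j)

theorem eval_root (j : Fin (deg k)) (x : U) :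
    eval x ((h.logRoot j).root : analyticAlgebra U) = ρ j x := rfl

theorem eval_der (j : Fin (deg k)) (x : U) :
    eval x ((h.logRoot j).der : analyticAlgebra U) =
      (derivative (genericPoly k x)).eval (ρ j x) := rfl

theorem ne_zero_of_eval {φ : analyticAlgebra U} (hφ : ∀ x, eval x φ ≠ 0) : φ ≠ 0 := by
  obtain ⟨x, hx⟩ := h.nonempty
  intro h0
  exact hφ ⟨x, hx⟩ (by rw [h0, map_zero])

/-- The roots over the algebra of analytic functions. -/
def rootSystem : RootSystem (coordinatesOn h.isOpen) k (Fin (deg k)) where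
  root := h.logRoot
  injective := fun i j hij he => by
    obtain ⟨x, hx⟩ := h.nonempty
    exact hij (h.injective x hx (congrArg (analyticAlgebra.eval ⟨x, hx⟩) he))
  x_zero_ne := h.ne_zero_of_eval fun x => h.zero_ne x x.2
  x_last_ne := h.ne_zero_of_eval fun x => h.last_ne x x.2
  sum_pow := fun s hs => eval_ext fun x => by
    have h1 := sum_pow_div_derivative h.strictMono (h.last_ne x x.2)
      (fun j => h.root_eval j x x.2) (h.injective x x.2) (s := s) (by omega)
    rw [if_neg (by omega)] at h1
    simp only [map_sum, map_mul, map_pow, map_zero, eval_unit_inv, h.eval_root, h.eval_der]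
    exact (mul_eq_zero.mp h1).resolve_left (h.last_ne x x.2)
  sum_pow_top := eval_ext fun x => by
    have hd : 0 < deg k := (Nat.zero_le _).trans_lt (h.strictMono (Fin.last_pos))
    have h1 := sum_pow_div_derivative h.strictMono (h.last_ne x x.2)
      (fun j => h.root_eval j x x.2) (h.injective x x.2) (s := deg k - 1) (by omega)
    rw [if_pos (by omega)] at h1
    simp only [map_sum, map_mul, map_pow, map_one, eval_unit_inv, h.eval_root, h.eval_der]
    exact h1

end RootsOn

theorem mulVec_curveMatrix {k : Fin (m + 2) → ℕ} (v : Fin (m + 2) → ℤ) :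
    (curveMatrix k).mulVec v = ![∑ j, v j, ∑ j, v j * k j] := by
  ext i
  fin_cases i <;> simp [curveMatrix, Matrix.mulVec, dotProduct, mul_comm]

/-- Since `k 0 = 0`, a representation of `a` leaves the multiplicity of the column `(1, 0)` free.
Matching the first coordinate requires that multiplicity to be non-negative or non-positive, which
puts `α` in `I(A)` or in `F_0(A)`. The column `(1, d)` plays this part for the second condition,
with `F_d(A)`. -/
theorem isGap_of_mem_setJ {α : Fin 2 → ℤ} (hk0 : k 0 = 0) (hα : α ∈ setJ k) :
    IsGap k (α 0) (α 1) := by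
  simp only [setJ, Set.mem_compl_iff, Set.mem_union, not_or] at hα
  obtain ⟨⟨hI, hF0⟩, hFd⟩ := hα
  have hI' : ∀ u : Fin (m + 2) → ℕ, α 0 = ∑ j, (u j : ℤ) → α 1 = ∑ j, (u j : ℤ) * k j →
      False := by
    intro u h0 h1
    refine hI ⟨u, ?_⟩
    rw [mulVec_curveMatrix]
    ext i
    fin_cases i
    · exact h0
    · exact h1
  constructor
  · intro u hu
    rcases lt_or_ge (∑ j : Fin (m + 1), (u j.succ : ℤ)) (α 0) with h | h
    · refine hI' (Fin.cons (α 0 - ∑ j : Fin (m + 1), (u j.succ : ℤ)).toNat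
        fun j => u j.succ) ?_ ?_
      · rw [Fin.sum_univ_succ]
        simp only [Fin.cons_zero, Fin.cons_succ]
        omega
      · rw [hu, Fin.sum_univ_succ, Fin.sum_univ_succ (fun j => ((Fin.cons _ _ : _ → ℕ) j : ℤ) * _)]
        simp [hk0]
    · refine hF0 ⟨fun j => u j.succ, (∑ j : Fin (m + 1), (u j.succ : ℤ) - α 0).toNat, ?_⟩
      ext i
      fin_cases i
      · simp [curveMatrix, Matrix.mulVec, dotProduct, h]
      · rw [Fin.sum_univ_succ] at hu
        simp [curveMatrix, Matrix.mulVec, dotProduct, hk0] at hu ⊢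
        rw [hu]
        exact Finset.sum_congr rfl fun j _ => mul_comm _ _
  · intro u hu
    have hu' : α 1 = (deg k : ℤ) * (α 0 - ∑ j : Fin (m + 1), (u j.castSucc : ℤ)) +
        ∑ j : Fin (m + 1), (u j.castSucc : ℤ) * k j.castSucc := by
      rw [Fin.sum_univ_castSucc] at hu
      simp only [mul_sub, Finset.sum_sub_distrib, ← Finset.sum_mul, deg] at hu ⊢
      linarith
    rcases lt_or_ge (∑ j : Fin (m + 1), (u j.castSucc : ℤ)) (α 0) with h | h
    · refine hI' (Fin.snoc (fun j => u j.castSucc)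
        (α 0 - ∑ j : Fin (m + 1), (u j.castSucc : ℤ)).toNat) ?_ ?_
      · rw [Fin.sum_univ_castSucc]
        simp only [Fin.snoc_last, Fin.snoc_castSucc]
        omega
      · rw [hu', Fin.sum_univ_castSucc (n := m + 1)]
        simp only [Fin.snoc_last, Fin.snoc_castSucc]
        rw [Int.toNat_of_nonneg (by omega), deg]
        ring
    · refine hFd ⟨fun j => u j.castSucc, (∑ j : Fin (m + 1), (u j.castSucc : ℤ) - α 0).toNat, ?_⟩
      ext i
      fin_cases i
      · simp [curveMatrix, Matrix.mulVec, dotProduct, h]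
      · simp [curveMatrix, Matrix.mulVec, dotProduct, h, hu']
        rw [Finset.sum_congr rfl fun j _ => mul_comm _ _]
        ring

theorem Phi_eq_zero {α : Fin 2 → ℤ} (hα : ∀ u : Fin (m + 2) → ℕ, α 1 ≠ ∑ j, (u j : ℤ) * k j)
    (x : Fin (m + 2) → ℂ) : Phi k α x = 0 := by
  rw [Phi, Finset.filter_eq_empty_iff.mpr, Finset.sum_empty]
  intro u _ hu
  rw [mulVec_curveMatrix] at hu
  exact hα u (by rw [← hu]; rfl)

theorem eval_coeff_divPow (hU : IsOpen U) (n l : ℕ) (x : U) :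
    eval x (((coordinatesOn hU).divPow k n).coeff l) = Phi k ![n, l] x := by
  rw [Coordinates.divPow_eq_sum, finsetSum_coeff, map_sum, Phi, Finset.sum_filter]
  refine Finset.sum_congr rfl fun u hu => ?_
  have hu' := (Finset.mem_piAntidiag.mp hu).1
  have h1 : (∑ j, u j * k j = l) ↔
      (curveMatrix k).mulVec (fun j => (u j : ℤ)) = ![(n : ℤ), (l : ℤ)] := by
    have h2 : n = ∑ j, u j := by simpa using hu'.symm
    rw [mulVec_curveMatrix, h2]
    constructor
    · rintro rfl
      push_cast
      rfl
    · intro h3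
      have := congrFun h3 1
      simp at this
      exact_mod_cast this
  rw [coeff_monomial]
  simp only [h1]
  split_ifs
  · rw [map_prod]
    refine Finset.prod_congr rfl fun j _ => ?_
    rw [map_mul, map_pow, AlgHom.commutes, div_eq_mul_inv]
    rfl
  · rw [map_zero]

theorem natDegree_divPow_le {R : Type*} [CommRing R] [Algebra ℂ R] (c : Coordinates m R)
    (hk : StrictMono k) (n : ℕ) : (c.divPow k n).natDegree ≤ deg k * n := by
  refine (natDegree_C_mul_le _ _).trans (natDegree_pow_le.trans ?_)
  rw [mul_comm]
  refine Nat.mul_le_mul_right n (natDegree_sum_le_of_forall_le _ _ fun j _ => ?_)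
  exact (natDegree_monomial_le _).trans (hk.monotone (Fin.le_last j))

namespace RootsOn

variable {ρ L : Fin (deg k) → (Fin (m + 2) → ℂ) → ℂ} (h : RootsOn k U ρ L)

include h

theorem eval_psiNat {α : Fin 2 → ℤ} (hα : ∀ u : Fin (m + 2) → ℕ, α 1 ≠ ∑ j, (u j : ℤ) * k j)
    (h0 : 0 ≤ α 0) (j : Fin (deg k)) (x : U) :
    eval x ((h.logRoot j).psiNat (α 0).toNat (α 1)) = psiNonneg k (ρ j) (L j) α x := by
  rw [LogRoot.psiNat, LogRoot.prim, weighted_eq_sum _ _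
    (Nat.lt_succ_of_le (natDegree_divPow_le (coordinatesOn h.isOpen) h.strictMono (α 0).toNat)),
    map_sum, psiNonneg, Phi_eq_zero hα, zero_mul, add_zero, Finset.sum_filter]
  refine Finset.sum_congr rfl fun l _ => ?_
  rw [map_mul, eval_coeff_divPow, Int.toNat_of_nonneg h0]
  split_ifs with h1
  · rw [LogRoot.primWeight, if_neg h1, map_mul, AlgHom.commutes, eval_unit_zpow, h.eval_root,
      div_eq_inv_mul]
    rfl
  · rw [Phi_eq_zero, zero_mul]
    intro u hu
    exact hα u (by rw [← not_not.mp h1]; exact hu)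

/-- Only the condition on `α 1` is assumed, since in negative degree the functions start from `(0, α
1)`, which need not be a gap. -/
theorem eval_psi {α : Fin 2 → ℤ} (hα : ∀ u : Fin (m + 2) → ℕ, α 1 ≠ ∑ j, (u j : ℤ) * k j)
    (j : Fin (deg k)) (x : U) :
    eval x ((h.logRoot j).psi (α 0) (α 1)) = MonomialCurve.psi k (ρ j) (L j) α x := by
  rw [LogRoot.psi, MonomialCurve.psi]
  split_ifs with h0
  · exact h.eval_psiNat hα h0 j x
  · exact eval_D_iterate h.isOpen (fun y => h.eval_psiNat (α := ![0, α 1]) hα le_rfl j y) 0 _ x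

theorem eval_psiLogSum {α : Fin 2 → ℤ}
    (hα : ∀ u : Fin (m + 2) → ℕ, α 1 ≠ ∑ j, (u j : ℤ) * k j) (x : U) :
    eval x (h.rootSystem.psiLogSum (α 0) (α 1)) = chiNonneg k ρ L α x := by
  rw [RootSystem.psiLogSum, map_sum, chiNonneg]
  refine Finset.sum_congr rfl fun j _ => ?_
  rw [map_mul]
  congr 1
  exact h.eval_psi hα j x

theorem eval_chi {α : Fin 2 → ℤ} (hα : IsGap k (α 0) (α 1)) (x : U) :
    eval x (h.rootSystem.chi (α 0) (α 1)) = MonomialCurve.chi k ρ L α x := by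
  rw [RootSystem.chi, MonomialCurve.chi]
  split_ifs with h0 h1
  · exact h.eval_psiLogSum hα.1 x
  · exact eval_D_iterate h.isOpen (fun y => h.eval_psiLogSum (α := ![0, α 1]) hα.1 y) 0 _ x
  -- The separate definition of `χ` for `α_2 = 0` never applies, because zero is an empty sum of the
  -- `k_j`.
  · exact absurd hα.ne_zero h1

end RootsOn

theorem DMulti_eq (hU : IsOpen U) {p : ℤ → ℤ → Prop} {F : ℤ → ℤ → analyticAlgebra U}
    (hp : ∀ n a i, p n a → p (n - 1) (a - k i))
    (hF : ∀ n a i, p n a → D hU i (F n a) = F (n - 1) (a - k i)) {n a : ℤ} (h : p n a)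
    (u : Fin (m + 2) → ℕ) :
    DMulti hU u (F n a) = F (n - ∑ j, (u j : ℤ)) (a - ∑ j, (u j : ℤ) * k j) := by
  have hiter : ∀ (i : Fin (m + 2)) (N : ℕ) {n a : ℤ}, p n a →
      p (n - N) (a - N * k i) ∧ (D hU i)^[N] (F n a) = F (n - N) (a - N * k i) := by
    intro i N n a hna
    induction N with
    | zero => simpa using hna
    | succ N ih =>
      have h1 := hp _ _ i ih.1
      have h2 := hF _ _ i ih.1
      rw [Function.iterate_succ_apply', ih.2, h2]
      have e1 : n - N - 1 = n - (N + 1 : ℕ) := by push_cast; ring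
      have e2 : a - N * k i - k i = a - (N + 1 : ℕ) * k i := by push_cast; ring
      rw [e1, e2] at h1 ⊢
      exact ⟨h1, rfl⟩
  have hlist : ∀ l : List (Fin (m + 2)),
      p (n - (l.map fun j => (u j : ℤ)).sum) (a - (l.map fun j => (u j : ℤ) * k j).sum) ∧
      l.foldr (fun j g => (D hU j)^[u j] g) (F n a) =
        F (n - (l.map fun j => (u j : ℤ)).sum) (a - (l.map fun j => (u j : ℤ) * k j).sum) := by
    intro l
    induction l with
    | nil => simpa using h
    | cons j l ih =>
      have h1 := hiter j (u j) ih.1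
      rw [List.foldr_cons, ih.2, h1.2]
      simp only [List.map_cons, List.sum_cons]
      have e1 : n - (l.map fun j => (u j : ℤ)).sum - u j =
          n - (u j + (l.map fun j => (u j : ℤ)).sum) := by ring
      have e2 : a - (l.map fun j => (u j : ℤ) * k j).sum - u j * k j =
          a - (u j * k j + (l.map fun j => (u j : ℤ) * k j).sum) := by ring
      rw [← e1, ← e2]
      exact ⟨h1.1, rfl⟩
  rw [DMulti, (hlist _).2, Fin.sum_univ_def, Fin.sum_univ_def]

/-- For a family obeying the shift rule both sides of a toric equation are the member at `α - A v⁺ =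
α - A v⁻`. -/
theorem isHypergeometricOn_of_family (hU : IsOpen U) {p : ℤ → ℤ → Prop}
    {F : ℤ → ℤ → analyticAlgebra U}
    (hp : ∀ n a i, p n a → p (n - 1) (a - k i))
    (hF : ∀ n a i, p n a → D hU i (F n a) = F (n - 1) (a - k i)) {α : Fin 2 → ℤ}
    (h : p (α 0) (α 1))
    (h0 : ∑ i, coord i * D hU i (F (α 0) (α 1)) = (α 0 : analyticAlgebra U) * F (α 0) (α 1))
    (h1 : ∑ i, (k i : analyticAlgebra U) * coord i * D hU i (F (α 0) (α 1)) =
      (α 1 : analyticAlgebra U) * F (α 0) (α 1))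
    {φ : (Fin (m + 2) → ℂ) → ℂ} (hφ : ∀ x : U, eval x (F (α 0) (α 1)) = φ x) :
    IsHypergeometricOn (curveMatrix k) (fun i => (α i : ℂ)) U φ where
  holomorphic := fun x hx =>
    ((ext_analyticOnNhd (F (α 0) (α 1)) x hx).differentiableAt.congr_of_eventuallyEq
      (Filter.eventuallyEq_of_mem (hU.mem_nhds hx)
        (ext_eqOn hφ).symm)).differentiableWithinAt
  toric := by
    intro v hv x hx
    rw [mulVec_curveMatrix] at hv
    have hv0 : ∑ j, v j = 0 := congrFun hv 0
    have hv1 : ∑ j, v j * k j = 0 := congrFun hv 1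
    have hsub : ∀ j, ((v j).toNat : ℤ) = v j + ((-v j).toNat : ℤ) := by intro j; omega
    rw [← eval_DMulti hU hφ _ ⟨x, hx⟩, ← eval_DMulti hU hφ _ ⟨x, hx⟩, DMulti_eq hU hp hF h,
      DMulti_eq hU hp hF h]
    simp only [hsub, add_mul, Finset.sum_add_distrib, hv0, hv1, zero_add]
  homogeneous := by
    intro i x hx
    have hD : ∀ j, pd j φ x = eval ⟨x, hx⟩ (D hU j (F (α 0) (α 1))) := fun j =>
      (eval_D hU hφ j ⟨x, hx⟩).symm
    have hφx := hφ ⟨x, hx⟩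
    simp only [hD]
    fin_cases i
    · have := congrArg (analyticAlgebra.eval ⟨x, hx⟩) h0
      simp only [map_sum, map_mul, map_intCast, hφx] at this
      refine Eq.trans (Finset.sum_congr rfl fun j _ => ?_) this
      simp [curveMatrix, coord, eval_of]
    · have := congrArg (analyticAlgebra.eval ⟨x, hx⟩) h1
      simp only [map_sum, map_mul, map_intCast, map_natCast, hφx] at this
      refine Eq.trans (Finset.sum_congr rfl fun j _ => ?_) this
      simp [curveMatrix, coord, eval_of]

theorem mem_algebraics_of_isAlgebraicOn (hU : IsOpen U) (hne : U.Nonempty)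
    [IsDomain (analyticAlgebra U)] {φ : analyticAlgebra U}
    {g : (Fin (m + 2) → ℂ) → ℂ} (hg : ∀ x : U, eval x φ = g x) (h : IsAlgebraicOn U g) :
    φ ∈ (coordinatesOn hU).algebraics := by
  obtain ⟨P, hP0, hP⟩ := h
  let f : MvPolynomial (Fin (m + 2)) ℂ →ₐ[ℂ] (coordinatesOn hU).polynomials :=
    (MvPolynomial.aeval fun i => ⟨coord i, (coordinatesOn hU).x_mem i⟩)
  have hf : ∀ p, ((f p : (coordinatesOn hU).polynomials) : analyticAlgebra U) =
      MvPolynomial.aeval coord p := by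
    intro p
    have : (coordinatesOn hU).polynomials.val.comp f = MvPolynomial.aeval coord :=
      MvPolynomial.algHom_ext fun i => by simp [f]
    exact DFunLike.congr_fun this p
  have hinj : Function.Injective f := fun p q hpq =>
    aeval_coord_injective hU hne (by rw [← hf, ← hf, hpq])
  refine Coordinates.mem_algebraics.mpr
    ⟨P.map f.toRingHom, (Polynomial.map_ne_zero_iff hinj).mpr hP0, ?_⟩
  refine eval_ext fun x => ?_
  rw [map_zero, ← hP x x.2, aeval_def, eval₂_map, eval_map]
  refine (hom_eval₂ P _ (eval x).toRingHom φ).trans ?_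
  rw [← hg x]
  refine eval₂_congr ?_ rfl rfl
  refine MvPolynomial.ringHom_ext (fun r => ?_) fun i => ?_
  · simp [f]
  · simp [f]
    rfl

end AnalyticRoots

end MonomialCurve

end

theorem theorem3p5 (m : ℕ) (hm : 1 ≤ m) (k : Fin (m + 2) → ℕ) (hk0 : k 0 = 0)
    (hk : StrictMono k) (hgcd : Finset.univ.gcd k = 1)
    (α : Fin 2 → ℤ) (hα : α ∈ MonomialCurve.setJ k)
    (U : Set (Fin (m + 2) → ℂ)) (hUo : IsOpen U) (hUsc : IsSimplyConnected U)
    (hUsing : U ⊆ (MonomialCurve.singularLocus k)ᶜ)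
    (ρ : Fin (MonomialCurve.deg k) → (Fin (m + 2) → ℂ) → ℂ)
    (hρ : ∀ j, DifferentiableOn ℂ (ρ j) U)
    (hroot : ∀ j, ∀ x ∈ U, (MonomialCurve.genericPoly k x).eval (ρ j x) = 0)
    (hdistinct : ∀ x ∈ U, Function.Injective (fun j => ρ j x))
    (L : Fin (MonomialCurve.deg k) → (Fin (m + 2) → ℂ) → ℂ)
    (hL : ∀ j, DifferentiableOn ℂ (L j) U)
    (hlog : ∀ j, ∀ x ∈ U, Complex.exp (L j x) = ρ j x) :
    (∀ j, MonomialCurve.IsHypergeometricOn (MonomialCurve.curveMatrix k) (fun i => (α i : ℂ)) U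
      (MonomialCurve.psi k (ρ j) (L j) α)) ∧
    MonomialCurve.IsHypergeometricOn (MonomialCurve.curveMatrix k) (fun i => (α i : ℂ)) U
      (MonomialCurve.chi k ρ L α) ∧
    LinearIndependent ℂ
      (Sum.elim
        (fun j : Fin (MonomialCurve.deg k - 1) =>
          U.domRestrict (MonomialCurve.psi k (ρ (Fin.castLE (Nat.sub_le _ 1) j))
            (L (Fin.castLE (Nat.sub_le _ 1) j)) α))
        (fun _ : Unit => U.domRestrict (MonomialCurve.chi k ρ L α))) ∧
    ¬ MonomialCurve.IsAlgebraicOn U (MonomialCurve.chi k ρ L α) := by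
  have hne : U.Nonempty := hUsc.nonempty
  have hconn : IsPreconnected U := hUsc.isPathConnected.isConnected.isPreconnected
  have hx : ∀ x ∈ U, x 0 ≠ 0 ∧ x (Fin.last (m + 1)) ≠ 0 := fun x hx =>
    ⟨fun h => hUsing hx (Or.inl (Or.inl h)), fun h => hUsing hx (Or.inl (Or.inr h))⟩
  have hρa : ∀ j, AnalyticOnNhd ℂ (ρ j) U := fun j x hxU =>
    MonomialCurve.analyticAt_root ((hρ j).differentiableAt (hUo.mem_nhds hxU)).continuousAt
      (Filter.eventually_of_mem (hUo.mem_nhds hxU) (hroot j))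
      (MonomialCurve.eval_derivative_genericPoly_ne_zero hk (hx x hxU).2
        (fun j => hroot j x hxU) (hdistinct x hxU) j)
  have h : MonomialCurve.RootsOn k U ρ L :=
    { isOpen := hUo
      nonempty := hne
      zero_ne := fun x hxU => (hx x hxU).1
      last_ne := fun x hxU => (hx x hxU).2
      root_analytic := hρa
      log_analytic := fun j x hxU => MonomialCurve.analyticAt_of_exp_eq
        ((hL j).differentiableAt (hUo.mem_nhds hxU)).continuousAt (hρa j x hxU)
        (Filter.eventually_of_mem (hUo.mem_nhds hxU) (hlog j))
      root_eval := hroot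
      exp_log := hlog
      injective := hdistinct
      strictMono := hk }
  have hdom : IsDomain (MonomialCurve.analyticAlgebra U) :=
    MonomialCurve.analyticAlgebra.isDomain hUo hconn hne
  -- Two different roots are needed for the transcendence of `χ`.
  have hd : 1 < MonomialCurve.deg k := by
    have h1 : k 0 < k 1 := hk (by simp)
    have h2 : k 1 < k (Fin.last (m + 1)) := hk (by
      rw [Fin.lt_def, Fin.val_last, Fin.val_one]
      omega)
    rw [MonomialCurve.deg]
    omega
  have hgap : MonomialCurve.IsGap k (α 0) (α 1) := MonomialCurve.isGap_of_mem_setJ hk0 hα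
  refine ⟨fun j => ?_, ?_, ?_, ?_⟩
  · have h1 := (h.logRoot j).sum_k_mul_x_mul_psi hk0 (α 0) (α 1)
    rw [MonomialCurve.Coordinates.phi_eq_zero _ hgap, sub_zero] at h1
    refine MonomialCurve.isHypergeometricOn_of_family hUo
      -- The shift rule for `ψ` holds at every exponent; for `χ` below it is available only on gaps.
      (p := fun _ _ => True) (fun _ _ _ _ => trivial)
      (F := (h.logRoot j).psi)
      (fun n a i _ => (h.logRoot j).D_psi hk0 i n a) trivial ?_ ?_ (h.eval_psi hgap.1 j)
    · rw [← (h.logRoot j).sum_x_mul_psi hk0]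
      exact Finset.sum_congr rfl fun i _ =>
        congrArg _ ((h.logRoot j).D_psi hk0 i (α 0) (α 1))
    · rw [← h1]
      exact Finset.sum_congr rfl fun i _ =>
        congrArg _ ((h.logRoot j).D_psi hk0 i (α 0) (α 1))
  · exact MonomialCurve.isHypergeometricOn_of_family hUo
      (p := MonomialCurve.IsGap k) (F := h.rootSystem.chi) (fun n a i hg => hg.sub_single i) (fun n a i hg => h.rootSystem.D_chi hk0 hk i hg) hgap
      (h.rootSystem.sum_x_mul_D_chi hk0 hk hgap) (h.rootSystem.sum_k_mul_x_mul_D_chi hk0 hk hgap)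
      (h.eval_chi hgap)
  · have hli := (h.rootSystem.linearIndependent_psi_chi hk0 hk hgcd hd hgap).map'
      (MonomialCurve.analyticAlgebra U).val.toLinearMap
      (LinearMap.ker_eq_bot.mpr Subtype.val_injective)
    convert! hli using 1
    ext (j | _) x
    · exact (h.eval_psi hgap.1 _ x).symm
    · exact (h.eval_chi hgap x).symm
  · intro halg
    exact h.rootSystem.chi_notMem_algebraics hk0 hk hgcd hd (Fintype.card_fin _) hgap
      (MonomialCurve.mem_algebraics_of_isAlgebraicOn hUo hne (h.eval_chi hgap) halg)
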